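/- Let $n\ge 1$, let $K\subset\mathbb R^n$ be a convex body (a compact convex set with non-empty interior) that is strictly convex (for distinct $y,z\in K$ the open segment between $y$ and $z$ lies in the interior of $K$), and let $\tau>0$. Write $|A|$ for Lebesgue measure and put $F(x)=|K\cap(x+\tau K)|$ for $x\in\mathbb R^n$. (a) For every $\delta$ with $0<\delta<\min(1,\tau^n)\,|K|$, the convolution body $K(\delta,\tau)=\{x\in\mathbb R^n : F(x)\ge\delta\}$ has boundary of class $C^1$: near each of its boundary points, $K(\delta,\tau)$ is the region on one side of the graph of a $C^1$ function over a hyperplane. (b) Let $N(y)$ denote the outer unit normal of $K$ at $y\in\partial K$, let $M(y)=M_x(y)$ denote the outer unit normal of $x+\tau K$ at $y\in\partial(x+\tau K)$, and let $\nu$ and $\mu=\mu_x$ be the $(n-1)$-dimensional surface (Hausdorff) measures on $\partial K$ and $\partial(x+\tau K)$. Then for every $x\in\mathbb R^n$ the normals $N$ and $M$ are uniquely determined almost everywhere with respect to $\nu$ and $\mu$, respectively, and are integrable. For every $x$ with $F(x)>0$ such that either $F(x)<\min(1,\tau^n)\,|K|$, or $n\ge2$ and $\tau\ne1$, the partial derivatives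 of $F$ at $x$ exist and, for $i=1,\dots,n$, $$\frac{\partial F}{\partial x_i}(x)=\int_{K\cap\partial(x+\tau K)}\langle M(y),e_i\rangle\,d\mu(y)=-\int_{(x+\tau K)\cap\partial K}\langle N(y),e_i\rangle\,d\nu(y),$$ where $e_1,\dots,e_n$ is the standard basis of $\mathbb R^n$. -/

import Mathlib

open MeasureTheory Set
open scoped Pointwise

noncomputable section

/-- `u` is an outer unit normal of the set `L` at the point `y`. -/
def IsOuterUnitNormal {n : ℕ} (L : Set (EuclideanSpace ℝ (Fin n)))
    (y u : EuclideanSpace ℝ (Fin n)) : Prop :=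
  ‖u‖ = 1 ∧ ∀ z ∈ L, inner ℝ u (z - y) ≤ 0

open Classical in
/-- The outer unit normal of `L` at `y` where there is exactly one; `0` elsewhere. -/
def outerUnitNormal {n : ℕ} (L : Set (EuclideanSpace ℝ (Fin n)))
    (y : EuclideanSpace ℝ (Fin n)) : EuclideanSpace ℝ (Fin n) :=
  if h : ∃! u, IsOuterUnitNormal L y u then h.choose else 0

/-- The surface measure of the boundary of `L`: the `(n-1)`-dimensional Hausdorff measure
(normalized to agree with Lebesgue measure on hyperplanes), restricted to `∂L`. -/
def surfaceMeasure {n : ℕ} (L : Set (EuclideanSpace ℝ (Fin n))) :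
    Measure (EuclideanSpace ℝ (Fin n)) :=
  (Measure.euclideanHausdorffMeasure (n - 1)).restrict (frontier L)

/-- The function `F(x) = |K ∩ (x + τK)|`. -/
def intersectionVolume {n : ℕ} (K : Set (EuclideanSpace ℝ (Fin n))) (τ : ℝ)
    (x : EuclideanSpace ℝ (Fin n)) : ℝ :=
  volume.real (K ∩ (x +ᵥ τ • K))

/-- The convolution body `K(δ, τ) = {x | |K ∩ (x + τK)| ≥ δ}`. -/
def convolutionBody {n : ℕ} (K : Set (EuclideanSpace ℝ (Fin n))) (δ τ : ℝ) :
    Set (EuclideanSpace ℝ (Fin n)) :=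
  {x | δ ≤ intersectionVolume K τ x}

/-- The boundary of `A` is of class `C¹`: near each boundary point, `A` is the region on one side
of the graph of a `C¹` function over a hyperplane `u^⊥`, with `u` a unit vector. -/
def HasC1Boundary {n : ℕ} (A : Set (EuclideanSpace ℝ (Fin n))) : Prop :=
  ∀ p ∈ frontier A, ∃ (u : EuclideanSpace ℝ (Fin n)) (U : Set (EuclideanSpace ℝ (Fin n)))
    (g : (Submodule.span ℝ {u})ᗮ → ℝ),
    ‖u‖ = 1 ∧ IsOpen U ∧ p ∈ U ∧
    (∀ z ∈ U, ContDiffAt ℝ 1 g ((Submodule.span ℝ {u})ᗮ.orthogonalProjectionOnto z)) ∧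
    ∀ z ∈ U, z ∈ A ↔ inner ℝ u z ≤ g ((Submodule.span ℝ {u})ᗮ.orthogonalProjectionOnto z)

end

/-! Cut everything by the lines in a unit direction `e`. On each line `K` and `x + τK` leave
intervals. When `x` moves along `e`, the length of their overlap changes at rate 1 if the upper end
of the second interval lies in `K`, minus 1 if its lower end does. Integrating over the hyperplane
orthogonal to `e`, the derivative of `F` is the difference of the areas of two shadows, those of the
upper and the lower part of `K ∩ ∂(x + τK)`. Each shadow area is the surface integral of the
positive part of a normal component (`setLIntegral_inner_outerUnitNormal`), whence
`hasDerivAt_volume_inter_vadd`. The second formula comes from moving `K` by `-te` instead of `x +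
τK` by `te`.

The surface measure is handled without charts. The support inequalities alone show that boundary
points with normals close to `u` form a set that is nearly flat orthogonally to `u`
(`abs_inner_sub_le_of_isOuterUnitNormal`). Covering the normals by small balls then gives finite
area, almost everywhere uniqueness of normals and the shadow formula.

A slice can fail to be differentiable where `∂K` meets `∂(x + τK)`, and this set is null
(`euclideanHausdorffMeasure_frontier_inter_frontier`). Points with independent normals are null;
opposite normals contradict `F(x) > 0`; equal normals force, by strict convexity, a fixed point of
the homothety `z ↦ x + τz`. A fixed point in `K` nests the two bodies, which is impossible while
`F(x)` is below its maximum. In the remaining case there is at most one fixed point, null because `n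
≥ 2`.

For the `C¹` boundary, the gradient is continuous by dominated convergence and nonzero where `F`
lies strictly between 0 and its maximum (`intersectionGradient_ne_zero`); the implicit function
theorem finishes. -/

/-! ### Hausdorff measure under orthogonal projection to a hyperplane -/

section HausdorffProjection

variable {V : Type*} [NormedAddCommGroup V] [InnerProductSpace ℝ V]

/-- The orthogonal projection onto the hyperplane orthogonal to `e`. -/
noncomputable abbrev perpProj (e : V) : V →L[ℝ] (Submodule.span ℝ {e})ᗮ :=
  (Submodule.span ℝ {e})ᗮ.orthogonalProjectionOnto

theorem coe_perpProj {e : V} (he : ‖e‖ = 1) (w : V) :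
    (perpProj e w : V) = w - inner ℝ e w • e := by
  have h := Submodule.starProjection_orthogonal_val (K := Submodule.span ℝ {e}) w
  rw [Submodule.starProjection_unit_singleton ℝ he] at h
  simpa using h

theorem inner_perpProj_right {e : V} (he : ‖e‖ = 1) (u w : V) :
    inner ℝ u (perpProj e w : V) = inner ℝ u w - inner ℝ e w * inner ℝ u e := by
  rw [coe_perpProj he, inner_sub_right, inner_smul_right]

theorem inner_self_perpProj {e : V} (he : ‖e‖ = 1) (w : V) :
    inner ℝ e (perpProj e w : V) = 0 := by
  rw [inner_perpProj_right he, real_inner_self_eq_norm_sq, he]; ring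

theorem norm_perpProj_sq {e : V} (he : ‖e‖ = 1) (w : V) :
    ‖perpProj e w‖ ^ 2 = ‖w‖ ^ 2 - inner ℝ e w ^ 2 := by
  rw [Submodule.coe_norm, coe_perpProj he, norm_sub_sq_real, inner_smul_right, norm_smul, he,
    real_inner_comm w e, mul_one, Real.norm_eq_abs, sq_abs]
  ring

theorem norm_perpProj_le (e w : V) : ‖perpProj e w‖ ≤ ‖w‖ :=
  Submodule.norm_orthogonalProjectionOnto_apply_le _ _

theorem finrank_perp {e : V} (he : ‖e‖ = 1) {d : ℕ} (hd : Module.finrank ℝ V = d + 1) :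
    Module.finrank ℝ (Submodule.span ℝ {e})ᗮ = d := by
  have : Fact (Module.finrank ℝ V = d + 1) := ⟨hd⟩
  exact Submodule.finrank_orthogonal_span_singleton (by rintro rfl; simp at he)

/-- On `s` the map `f` factors through `g`, and the factor `g '' s → f '' s` is `K`-Lipschitz. With
`f = id` this bounds a set by its projection. -/
theorem euclideanHausdorffMeasure_image_le_image {X Y Z : Type*} [EMetricSpace Y]
    [MeasurableSpace Y] [BorelSpace Y] [EMetricSpace Z] [MeasurableSpace Z] [BorelSpace Z]
    {f : X → Y} {g : X → Z} {s : Set X} {K : NNReal} (d : ℕ)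
    (h : ∀ x ∈ s, ∀ y ∈ s, edist (f x) (f y) ≤ K * edist (g x) (g y)) :
    μHE[d] (f '' s) ≤ (K : ENNReal) ^ d * μHE[d] (g '' s) := by
  rcases s.eq_empty_or_nonempty with rfl | ⟨x₀, -⟩
  · simp
  have : Nonempty X := ⟨x₀⟩
  set φ : Z → Y := f ∘ Function.invFunOn g s
  have hinv : ∀ x ∈ s, g (Function.invFunOn g s (g x)) = g x := fun x hx =>
    Function.invFunOn_eq ⟨x, hx, rfl⟩
  have hmem : ∀ x ∈ s, Function.invFunOn g s (g x) ∈ s := fun x hx =>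
    Function.invFunOn_mem ⟨x, hx, rfl⟩
  have hφ : LipschitzOnWith K φ (g '' s) := by
    rintro _ ⟨x, hx, rfl⟩ _ ⟨y, hy, rfl⟩
    have := h _ (hmem x hx) _ (hmem y hy)
    rwa [hinv x hx, hinv y hy] at this
  have himg : φ '' (g '' s) = f '' s := by
    rw [image_image]
    refine image_congr fun x hx => ?_
    have := h _ (hmem x hx) _ hx
    rw [hinv x hx, edist_self, mul_zero, nonpos_iff_eq_zero, edist_eq_zero] at this
    exact this
  have := hφ.hausdorffMeasure_image_le (Nat.cast_nonneg d)
  rw [himg, ENNReal.rpow_natCast] at this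
  simp only [Measure.euclideanHausdorffMeasure_def, Measure.smul_apply,
    Measure.nnreal_smul_coe_apply]
  rw [mul_left_comm]
  gcongr

variable [FiniteDimensional ℝ V] [MeasurableSpace V] [BorelSpace V]

omit [FiniteDimensional ℝ V] in
theorem euclideanHausdorffMeasure_perpProj_le (e : V) (d : ℕ) (s : Set V) :
    μHE[d] (perpProj e '' s) ≤ μHE[d] s := by
  have := euclideanHausdorffMeasure_image_le_image (f := perpProj e) (g := (id : V → V))
    (s := s) (K := 1) d fun x _ y _ => by
      rw [ENNReal.coe_one, one_mul, edist_dist, edist_dist, dist_eq_norm, dist_eq_norm,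
        ← map_sub]
      exact ENNReal.ofReal_le_ofReal (norm_perpProj_le e _)
  simpa using this

/-- Projecting one hyperplane orthogonally to another scales area by the inner product of the
unit normals. -/
theorem euclideanHausdorffMeasure_perpProj_perpProj {u e : V} (hu : ‖u‖ = 1) (he : ‖e‖ = 1)
    (hue : 0 ≤ inner ℝ u e) {d : ℕ} (hd : Module.finrank ℝ V = d + 1)
    (s : Set (Submodule.span ℝ {u})ᗮ) :
    μHE[d] ((fun w : (Submodule.span ℝ {u})ᗮ => perpProj e (w : V)) '' s) =
      ENNReal.ofReal (inner ℝ u e) * μHE[d] s := by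
  set f : (Submodule.span ℝ {u})ᗮ →L[ℝ] (Submodule.span ℝ {e})ᗮ :=
    perpProj e ∘L (Submodule.span ℝ {u})ᗮ.subtypeL with hf
  have hker : ∀ w : (Submodule.span ℝ {u})ᗮ, inner ℝ u (w : V) = 0 := fun w =>
    Submodule.mem_orthogonal_singleton_iff_inner_right.1 w.2
  -- The Gram operator is `w ↦ w - ⟪e, w⟫ P_u e`, a rank-one perturbation of the identity. Its
  -- determinant `1 - ⟪e, P_u e⟫ = ⟪u, e⟫²` is the square of the area factor.
  have hadj : (f.adjoint ∘L f).toLinearMap =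
      LinearMap.transvection (-(innerₛₗ ℝ e ∘ₗ (Submodule.span ℝ {u})ᗮ.subtype))
        (perpProj u e) := by
    apply LinearMap.ext
    intro w
    refine ext_inner_right ℝ fun v => ?_
    have h1 : inner ℝ ((f.adjoint ∘L f) w) v = inner ℝ (f w) (f v) := by
      rw [ContinuousLinearMap.comp_apply, ContinuousLinearMap.adjoint_inner_left]
    have h2 : inner ℝ (perpProj u e) v = inner ℝ e (v : V) := by
      rw [Submodule.coe_inner, coe_perpProj hu, inner_sub_left, inner_smul_left, hker]
      simp
    have h3 : inner ℝ (f w) (f v) = inner ℝ (w : V) (v : V) - inner ℝ e (w : V) * inner ℝ e (v : V) := by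
      change inner ℝ (perpProj e (w : V)) (perpProj e (v : V)) = _
      rw [Submodule.coe_inner, coe_perpProj he, coe_perpProj he]
      simp only [inner_sub_left, inner_sub_right, inner_smul_left, inner_smul_right,
        real_inner_self_eq_norm_sq, he, real_inner_comm e (w : V)]
      simp
    change inner ℝ ((f.adjoint ∘L f) w) v = _
    rw [h1, h3, LinearMap.transvection.apply, inner_add_left, inner_smul_left, h2]
    simp
    ring
  have hdet : f.toLinearMap.normDet = inner ℝ u e := by
    have h := f.normDet_sq
    have h' : (f.adjoint ∘L f).det = inner ℝ u e ^ 2 := by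
      change LinearMap.det (f.adjoint ∘L f).toLinearMap = _
      rw [hadj, LinearMap.transvection.det]
      simp only [LinearMap.neg_apply, LinearMap.comp_apply, Submodule.subtype_apply,
        innerₛₗ_apply_apply]
      rw [inner_perpProj_right hu, real_inner_self_eq_norm_sq, he, real_inner_comm u e]
      ring
    rw [h'] at h
    exact (sq_eq_sq₀ (LinearMap.normDet_nonneg _) hue).1 h
  have := f.toLinearMap.euclideanHausdorffMeasure_image s
  rw [finrank_perp hu hd, hdet] at this
  exact this

theorem exists_one_lt_pow_le (d : ℕ) {η : ℝ} (hη : 1 < η) : ∃ κ : ℝ, 1 < κ ∧ κ ^ d ≤ η := by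
  have h : Filter.Tendsto (fun x : ℝ => x ^ d) (nhdsWithin 1 (Ioi 1)) (nhds (1 ^ d)) :=
    ((continuous_pow d).tendsto 1).mono_left nhdsWithin_le_nhds
  rw [one_pow] at h
  obtain ⟨κ, h1, h2⟩ := ((h.eventually_le_const hη).and self_mem_nhdsWithin).exists
  exact ⟨κ, h2, h1⟩

/-- A set that is nearly flat orthogonally to `u` has nearly the projected area of a subset of
the hyperplane orthogonal to `u`. -/
theorem exists_flatness_perpProj {u e : V} (hu : ‖u‖ = 1) (he : ‖e‖ = 1)
    (hue : 0 < inner ℝ u e) {d : ℕ} (hd : Module.finrank ℝ V = d + 1) {η : ℝ} (hη : 1 < η) :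
    ∃ ε > 0, ∀ A : Set V,
      (∀ y ∈ A, ∀ z ∈ A, |inner ℝ u (y - z)| ≤ ε * ‖y - z‖) →
      μHE[d] (perpProj e '' A) ≤ ENNReal.ofReal η * (ENNReal.ofReal (inner ℝ u e) * μHE[d] A) ∧
      ENNReal.ofReal (inner ℝ u e) * μHE[d] A ≤ ENNReal.ofReal η * μHE[d] (perpProj e '' A) := by
  -- The second estimate compares two pairs of sets, each at a cost of `κ ^ d`; hence the exponent
  -- `d + d`.
  obtain ⟨κ, hκ1, hκ⟩ := exists_one_lt_pow_le (d + d) hη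
  set c : ℝ := inner ℝ u e with hc
  have hc1 : c ≤ 1 := by
    have := real_inner_le_norm u e
    rwa [hu, he, one_mul] at this
  have hκ0 : 0 < κ := by linarith
  have hκi : 0 < 1 - κ⁻¹ := by
    have := inv_lt_one_of_one_lt₀ hκ1
    linarith
  have hκκ : κ * κ⁻¹ = 1 := mul_inv_cancel₀ hκ0.ne'
  -- The bound `1 / 2` gives `‖w‖ ≤ 2 ‖P_u w‖`; the other bound then makes the error `ε ‖w‖` at most
  -- `(1 - κ⁻¹) ‖P_e (P_u w)‖`.
  set ε : ℝ := min (1 / 2) (c / 2 * (1 - κ⁻¹)) with hε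
  have hε0 : 0 < ε := lt_min (by norm_num) (by positivity)
  have hε1 : ε ≤ 1 / 2 := min_le_left _ _
  have hε2 : ε ≤ c / 2 * (1 - κ⁻¹) := min_le_right _ _
  have hε3 : 1 ≤ κ * (1 - ε) := by nlinarith
  refine ⟨ε, hε0, fun A hA => ?_⟩
  -- Flattening first onto `uᗮ` and then projecting to `eᗮ` has a known area factor; on `A` this
  -- differs little from projecting directly.
  set p : V → (Submodule.span ℝ {e})ᗮ := fun y => perpProj e (perpProj u y : V) with hp
  have key : ∀ y ∈ A, ∀ z ∈ A, ‖y - z‖ ≤ κ * ‖perpProj u y - perpProj u z‖ ∧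
      ‖perpProj e y - perpProj e z‖ ≤ κ * ‖p y - p z‖ ∧
      ‖p y - p z‖ ≤ κ * ‖perpProj e y - perpProj e z‖ := by
    intro y hy z hz
    set w := y - z with hw
    have hAw : |inner ℝ u w| ≤ ε * ‖w‖ := hA y hy z hz
    have e1 : perpProj u y - perpProj u z = perpProj u w := (map_sub _ _ _).symm
    have e2 : perpProj e y - perpProj e z = perpProj e w := (map_sub _ _ _).symm
    have e3 : p y - p z = perpProj e (perpProj u w : V) := by
      simp only [hp, hw, map_sub, Submodule.coe_sub]
    rw [e1, e2, e3]
    set v : V := (perpProj u w : V) with hv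
    have hwv : w = v + inner ℝ u w • u := by rw [hv, coe_perpProj hu]; abel
    have huv : inner ℝ u v = 0 := inner_self_perpProj hu w
    have n1 : ‖w‖ ≤ ‖v‖ + ε * ‖w‖ := by
      calc ‖w‖ = ‖v + inner ℝ u w • u‖ := by rw [← hwv]
        _ ≤ ‖v‖ + ‖inner ℝ u w • u‖ := norm_add_le _ _
        _ ≤ _ := by rw [norm_smul, hu, mul_one, Real.norm_eq_abs]; gcongr
    have n2 : c * ‖v‖ ≤ ‖perpProj e v‖ := by
      have h1 := norm_perpProj_sq he v
      have h2 : inner ℝ e v = inner ℝ (perpProj u e : V) v := by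
        rw [coe_perpProj hu, inner_sub_left, inner_smul_left, huv]; simp
      have h3 : (inner ℝ e v) ^ 2 ≤ (1 - c ^ 2) * ‖v‖ ^ 2 := by
        have h4 := norm_perpProj_sq hu e
        rw [he] at h4
        have h5 := abs_real_inner_le_norm (perpProj u e : V) v
        rw [h2, ← sq_abs]
        calc _ ≤ (‖(perpProj u e : V)‖ * ‖v‖) ^ 2 := by gcongr
          _ = _ := by rw [mul_pow, ← Submodule.coe_norm, h4]; ring
      refine (sq_le_sq₀ (by positivity) (norm_nonneg _)).1 ?_
      rw [h1]; nlinarith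
    have n3 : perpProj e w = perpProj e v + inner ℝ u w • perpProj e u := by
      conv_lhs => rw [hwv]
      rw [map_add, map_smul]
    have n4 : ‖inner ℝ u w • perpProj e u‖ ≤ ε * ‖w‖ := by
      rw [norm_smul, Real.norm_eq_abs]
      have := norm_perpProj_le e u
      rw [hu] at this
      calc _ ≤ |inner ℝ u w| * 1 := by gcongr
        _ ≤ _ := by rw [mul_one]; exact hAw
    have hw0 := norm_nonneg w
    have hv0 := norm_nonneg v
    have hP0 := norm_nonneg (perpProj e v)
    have n5 : ε * ‖w‖ ≤ (1 - κ⁻¹) * ‖perpProj e v‖ := by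
      have : ‖w‖ ≤ 2 * ‖v‖ := by nlinarith
      calc ε * ‖w‖ ≤ (c / 2 * (1 - κ⁻¹)) * (2 * ‖v‖) := by gcongr
        _ = (1 - κ⁻¹) * (c * ‖v‖) := by ring
        _ ≤ _ := by gcongr
    have hvn : ‖perpProj u w‖ = ‖v‖ := rfl
    rw [hvn]
    refine ⟨?_, ?_, ?_⟩
    · have : (1 - ε) * ‖w‖ ≤ ‖v‖ := by linarith
      calc ‖w‖ ≤ (κ * (1 - ε)) * ‖w‖ := le_mul_of_one_le_left hw0 hε3
        _ = κ * ((1 - ε) * ‖w‖) := by ring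
        _ ≤ _ := by gcongr
    · rw [n3]
      have h2 : 2 - κ⁻¹ ≤ κ := by
        have : 0 ≤ (κ - 1) ^ 2 * κ⁻¹ := by positivity
        have : (κ - 1) ^ 2 * κ⁻¹ = κ - 2 + κ⁻¹ := by
          field_simp; ring
        linarith
      calc _ ≤ ‖perpProj e v‖ + ‖inner ℝ u w • perpProj e u‖ := norm_add_le _ _
        _ ≤ ‖perpProj e v‖ + (1 - κ⁻¹) * ‖perpProj e v‖ := by linarith
        _ = (2 - κ⁻¹) * ‖perpProj e v‖ := by ring
        _ ≤ _ := by gcongr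
    · have h1 : ‖perpProj e v‖ ≤ ‖perpProj e w‖ + ε * ‖w‖ := by
        have : perpProj e v = perpProj e w - inner ℝ u w • perpProj e u := by rw [n3]; abel
        calc ‖perpProj e v‖ = ‖perpProj e w - inner ℝ u w • perpProj e u‖ := by rw [← this]
          _ ≤ ‖perpProj e w‖ + ‖inner ℝ u w • perpProj e u‖ := norm_sub_le _ _
          _ ≤ _ := by linarith
      have h2 : κ⁻¹ * ‖perpProj e v‖ ≤ ‖perpProj e w‖ := by linarith
      calc ‖perpProj e v‖ = κ * (κ⁻¹ * ‖perpProj e v‖) := by rw [← mul_assoc, hκκ, one_mul]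
        _ ≤ _ := by gcongr
  have toE : ∀ {X Y : Type _} [NormedAddCommGroup X] [NormedAddCommGroup Y] {a b : X} {a' b' : Y},
      ‖a - b‖ ≤ κ * ‖a' - b'‖ → edist a b ≤ (κ.toNNReal : ENNReal) * edist a' b' := by
    intro X Y _ _ a b a' b' h
    rw [edist_dist, edist_dist, dist_eq_norm, dist_eq_norm]
    change _ ≤ ENNReal.ofReal κ * _
    rw [← ENNReal.ofReal_mul hκ0.le]
    exact ENNReal.ofReal_le_ofReal h
  set k : ENNReal := (κ.toNNReal : ENNReal) with hk
  have hk' : k ^ (d + d) ≤ ENNReal.ofReal η := by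
    rw [hk]
    change ENNReal.ofReal κ ^ _ ≤ _
    rw [← ENNReal.ofReal_pow hκ0.le]
    exact ENNReal.ofReal_le_ofReal hκ
  have hk1 : 1 ≤ k := by
    rw [hk]
    change 1 ≤ ENNReal.ofReal κ
    rw [← ENNReal.ofReal_one]
    exact ENNReal.ofReal_le_ofReal hκ1.le
  have hlin : μHE[d] (p '' A) = ENNReal.ofReal c * μHE[d] (perpProj u '' A) := by
    rw [← euclideanHausdorffMeasure_perpProj_perpProj hu he hue.le hd, image_image]
  refine ⟨?_, ?_⟩
  · calc μHE[d] (perpProj e '' A) ≤ k ^ d * μHE[d] (p '' A) :=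
          euclideanHausdorffMeasure_image_le_image d fun y hy z hz => toE (key y hy z hz).2.1
      _ = k ^ d * (ENNReal.ofReal c * μHE[d] (perpProj u '' A)) := by rw [hlin]
      _ ≤ ENNReal.ofReal η * (ENNReal.ofReal c * μHE[d] A) := by
          gcongr
          · exact (pow_le_pow_right₀ hk1 (by omega)).trans hk'
          · exact euclideanHausdorffMeasure_perpProj_le u d A
  · have h1 : μHE[d] A ≤ k ^ d * μHE[d] (perpProj u '' A) := by
      have := euclideanHausdorffMeasure_image_le_image (f := (id : V → V)) d
        fun y hy z hz => toE (key y hy z hz).1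
      simpa using this
    have h2 : μHE[d] (p '' A) ≤ k ^ d * μHE[d] (perpProj e '' A) :=
      euclideanHausdorffMeasure_image_le_image d fun y hy z hz => toE (key y hy z hz).2.2
    calc ENNReal.ofReal c * μHE[d] A
        ≤ ENNReal.ofReal c * (k ^ d * μHE[d] (perpProj u '' A)) := by gcongr
      _ = k ^ d * μHE[d] (p '' A) := by rw [hlin, mul_left_comm]
      _ ≤ k ^ d * (k ^ d * μHE[d] (perpProj e '' A)) := by gcongr
      _ = k ^ (d + d) * μHE[d] (perpProj e '' A) := by rw [pow_add, mul_assoc]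
      _ ≤ _ := by gcongr

end HausdorffProjection

/-! ### Outer normals, regular boundary points and surface area -/

section Normals

variable {n : ℕ} {L A B : Set (EuclideanSpace ℝ (Fin n))} {y z u v e : EuclideanSpace ℝ (Fin n)}

local notation "E" => EuclideanSpace ℝ (Fin n)

/-- The support inequality at `y` tested on `z` and the one at `z` tested on `y` bound the component
of the chord along `u₀` from both sides, up to the error made in replacing each normal by `u₀`. -/
theorem abs_inner_sub_le_of_isOuterUnitNormal {ε : ℝ} {u₀ : E} (hy : y ∈ L) (hz : z ∈ L)
    (hu : IsOuterUnitNormal L y u) (hv : IsOuterUnitNormal L z v) (hu₀ : ‖u - u₀‖ ≤ ε)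
    (hv₀ : ‖v - u₀‖ ≤ ε) : |inner ℝ u₀ (y - z)| ≤ ε * ‖y - z‖ := by
  have h1 := hu.2 z hz
  have h2 := hv.2 y hy
  have h3 := (abs_real_inner_le_norm (u - u₀) (z - y)).trans
    (mul_le_mul_of_nonneg_right hu₀ (norm_nonneg _))
  have h4 := (abs_real_inner_le_norm (v - u₀) (y - z)).trans
    (mul_le_mul_of_nonneg_right hv₀ (norm_nonneg _))
  rw [norm_sub_rev z y] at h3
  rw [inner_sub_left, abs_le] at h3 h4
  have h5 : inner ℝ u₀ (z - y) = - inner ℝ u₀ (y - z) := by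
    rw [← inner_neg_right, neg_sub]
  rw [abs_le]
  constructor <;> linarith

/-- The set of outer unit normals, as a relation on points and unit vectors, is closed. -/
theorem isClosed_isOuterUnitNormal (L : Set E) :
    IsClosed {p : E × Metric.sphere (0 : E) 1 | IsOuterUnitNormal L p.1 p.2} := by
  have : {p : E × Metric.sphere (0 : E) 1 | IsOuterUnitNormal L p.1 p.2} =
      ⋂ z ∈ L, {p | inner ℝ (p.2 : E) (z - p.1) ≤ 0} := by
    ext p
    simp [IsOuterUnitNormal]
  rw [this]
  exact isClosed_biInter fun z _ => isClosed_le (by fun_prop) (by fun_prop)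

/-- The pairs of normals range over a product of compact spheres, and projecting along a compact
factor is a closed map. -/
theorem isClosed_exists_isOuterUnitNormal (L : Set E) {C : Set (E × E)} (hC : IsClosed C) :
    IsClosed {y | ∃ u v, IsOuterUnitNormal L y u ∧ IsOuterUnitNormal L y v ∧ (u, v) ∈ C} := by
  let S := Metric.sphere (0 : E) 1
  have h := isClosed_isOuterUnitNormal L
  let D : Set (E × (S × S)) := {p | IsOuterUnitNormal L p.1 p.2.1} ∩
    {p | IsOuterUnitNormal L p.1 p.2.2} ∩ {p | ((p.2.1 : E), (p.2.2 : E)) ∈ C}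
  have hD : IsClosed D := by
    refine (IsClosed.inter ?_ ?_).inter ?_
    · exact h.preimage (f := fun p : E × (S × S) => (p.1, p.2.1)) (by fun_prop)
    · exact h.preimage (f := fun p : E × (S × S) => (p.1, p.2.2)) (by fun_prop)
    · exact hC.preimage (f := fun p : E × (S × S) => ((p.2.1 : E), (p.2.2 : E))) (by fun_prop)
  convert isClosedMap_fst_of_compactSpace D hD
  ext y
  constructor
  · rintro ⟨u, v, hu, hv, huv⟩
    exact ⟨(y, (⟨u, by simpa [S] using hu.1⟩, ⟨v, by simpa [S] using hv.1⟩)),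
      ⟨⟨hu, hv⟩, huv⟩, rfl⟩
  · rintro ⟨⟨y, u, v⟩, ⟨⟨hu, hv⟩, huv⟩, rfl⟩
    exact ⟨u, v, hu, hv, huv⟩

/-- The boundary points at which the outer unit normal is unique. -/
def regularBoundary (L : Set E) : Set E :=
  frontier L ∩ {y | ∃! u, IsOuterUnitNormal L y u}

theorem outerUnitNormal_spec (h : ∃! u, IsOuterUnitNormal L y u) :
    IsOuterUnitNormal L y (outerUnitNormal L y) := by
  rw [outerUnitNormal, dif_pos h]
  exact h.choose_spec.1

theorem outerUnitNormal_eq (h : ∃! u, IsOuterUnitNormal L y u) (hu : IsOuterUnitNormal L y u) :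
    outerUnitNormal L y = u :=
  h.unique (outerUnitNormal_spec h) hu

theorem norm_outerUnitNormal_le (L : Set E) (y : E) : ‖outerUnitNormal L y‖ ≤ 1 := by
  by_cases h : ∃! u, IsOuterUnitNormal L y u
  · exact (outerUnitNormal_spec h).1.le
  · simp [outerUnitNormal, dif_neg h]

/-- Where the normal is unique, the preimage of a closed set is the trace of the closed set of
points having some normal in it. -/
theorem continuousOn_outerUnitNormal (L : Set E) :
    ContinuousOn (outerUnitNormal L) (regularBoundary L) := by
  refine continuousOn_iff_isClosed.2 fun t ht =>
    ⟨_, isClosed_exists_isOuterUnitNormal L (ht.preimage continuous_fst), ?_⟩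
  ext y
  refine and_congr_left fun hy => ?_
  have hs := outerUnitNormal_spec hy.2
  constructor
  · exact fun h => ⟨_, _, hs, hs, h⟩
  · rintro ⟨u, v, hu, -, hut⟩
    have hut : u ∈ t := hut
    change outerUnitNormal L y ∈ t
    rwa [outerUnitNormal_eq hy.2 hu]

/-- Non-uniqueness means two normals at distance at least `1 / (k + 1)` for some `k`, a countable
union of closed conditions. -/
theorem measurableSet_regularBoundary (L : Set E) : MeasurableSet (regularBoundary L) := by
  have h : regularBoundary L = frontier L ∩
      ({y | ∃ u v, IsOuterUnitNormal L y u ∧ IsOuterUnitNormal L y v ∧ (u, v) ∈ univ} \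
      ⋃ k : ℕ, {y | ∃ u v, IsOuterUnitNormal L y u ∧ IsOuterUnitNormal L y v ∧
        (u, v) ∈ {p : E × E | 1 / ((k : ℝ) + 1) ≤ dist p.1 p.2}}) := by
    ext y
    refine and_congr_right fun _ => ?_
    simp only [mem_sdiff, mem_ofPred_eq, mem_univ, and_true, mem_iUnion, not_exists]
    constructor
    · rintro ⟨u, hu, huniq⟩
      refine ⟨⟨u, u, hu, hu⟩, ?_⟩
      rintro k a b ⟨ha, hb, hab⟩
      rw [huniq a ha, huniq b hb, dist_self] at hab
      exact absurd hab (not_le.2 (by positivity))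
    · rintro ⟨⟨u, -, hu, -⟩, hk⟩
      refine ⟨u, hu, fun v hv => ?_⟩
      by_contra hne
      obtain ⟨k, hk'⟩ := exists_nat_one_div_lt (dist_pos.2 hne)
      exact hk k v u ⟨hv, hu, hk'.le⟩
  rw [h]
  refine isClosed_frontier.measurableSet.inter
    ((isClosed_exists_isOuterUnitNormal L isClosed_univ).measurableSet.diff
      (MeasurableSet.iUnion fun k => (isClosed_exists_isOuterUnitNormal L ?_).measurableSet))
  exact isClosed_le continuous_const (by fun_prop)

/-- Hahn–Banach separates `y` from the open interior; the inequality passes to `L`, which lies in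
the closure of its interior. -/
theorem exists_isOuterUnitNormal (hL : Convex ℝ L) (hint : (interior L).Nonempty)
    (hy : y ∈ frontier L) : ∃ u, IsOuterUnitNormal L y u := by
  obtain ⟨f, hf⟩ := geometric_hahn_banach_open_point hL.interior isOpen_interior hy.2
  set w := (InnerProductSpace.toDual ℝ E).symm f with hw
  have hfw : ∀ x, f x = inner ℝ w x := fun x => by
    rw [hw, InnerProductSpace.toDual_symm_apply]
  obtain ⟨x₀, hx₀⟩ := hint
  have hw0 : 0 < ‖w‖ := by
    rw [norm_pos_iff]
    intro h
    have := hf x₀ hx₀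
    simp [hfw, h] at this
  refine ⟨‖w‖⁻¹ • w, by rw [norm_smul, norm_inv, norm_norm, inv_mul_cancel₀ hw0.ne'],
    fun z hz => ?_⟩
  have hz' : z ∈ closure (interior L) := by
    rw [hL.closure_interior_eq_closure_of_nonempty_interior ⟨x₀, hx₀⟩]
    exact subset_closure hz
  have hle : f z ≤ f y := by
    have : closure (interior L) ⊆ {x | f x ≤ f y} :=
      closure_minimal (fun x hx => (hf x hx).le) (isClosed_le f.continuous continuous_const)
    exact this hz'
  rw [inner_smul_left, inner_sub_right, ← hfw, ← hfw]
  exact mul_nonpos_of_nonneg_of_nonpos (by simp) (by linarith)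

theorem IsOuterUnitNormal.inner_neg_of_mem_interior (hu : IsOuterUnitNormal L y u)
    (hz : z ∈ interior L) : inner ℝ u (z - y) < 0 := by
  have hc : Filter.Tendsto (fun t : ℝ => z + t • u) (nhdsWithin 0 (Ioi 0)) (nhds z) := by
    have : Continuous fun t : ℝ => z + t • u := by fun_prop
    have := (this.tendsto 0).mono_left (nhdsWithin_le_nhds (s := Ioi 0))
    simpa using this
  obtain ⟨t, ht, ht0⟩ := ((hc.eventually (mem_interior_iff_mem_nhds.1 hz)).and
    self_mem_nhdsWithin).exists
  have := hu.2 _ ht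
  rw [add_sub_right_comm, inner_add_right, inner_smul_right, real_inner_self_eq_norm_sq, hu.1] at this
  have ht0 : 0 < t := ht0
  linarith

theorem ne_neg_of_isOuterUnitNormal (hint : (interior (A ∩ B)).Nonempty)
    (hu : IsOuterUnitNormal A y u) (hv : IsOuterUnitNormal B y v) : u ≠ -v := by
  rintro rfl
  obtain ⟨x, hx⟩ := hint
  have h1 := hu.inner_neg_of_mem_interior (interior_mono inter_subset_left hx)
  have h2 := hv.inner_neg_of_mem_interior (interior_mono inter_subset_right hx)
  rw [inner_neg_left] at h1
  linarith

/-- Chords nearly orthogonal to both `u` and `v` are controlled by their component orthogonal to the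
plane `M` spanned by them. Such a set is a Lipschitz image of a subset of `Mᗮ`, which has dimension
`n - 2`. -/
theorem exists_flatness_null {u v : E} (hu : ‖u‖ = 1) (hv : ‖v‖ = 1) (h1 : u ≠ v) (h2 : u ≠ -v) :
    ∃ ε > 0, ∀ T : Set E,
      (∀ y ∈ T, ∀ z ∈ T, |inner ℝ u (y - z)| ≤ ε * ‖y - z‖ ∧ |inner ℝ v (y - z)| ≤ ε * ‖y - z‖) →
      μHE[n - 1] T = 0 := by
  have hli : LinearIndependent ℝ ![u, v] := by
    refine LinearIndependent.pair_iff.2 fun s t hst => ?_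
    by_contra hne
    have hns : |s| = |t| := by
      have : s • u = -(t • v) := eq_neg_of_add_eq_zero_left hst
      have := congrArg norm this
      rwa [norm_neg, norm_smul, norm_smul, hu, hv, mul_one, mul_one] at this
    have hs0 : s ≠ 0 := by
      rintro rfl
      rw [abs_zero, eq_comm, abs_eq_zero] at hns
      exact hne ⟨rfl, hns⟩
    rcases abs_eq_abs.1 hns with rfl | rfl
    · rw [← smul_add, smul_eq_zero] at hst
      exact h2 (eq_neg_of_add_eq_zero_left (hst.resolve_left hs0))
    · rw [neg_smul, neg_add_eq_zero] at hst
      exact h1 (smul_right_injective _ (by simpa using hs0) hst)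
  set M : Submodule ℝ E := Submodule.span ℝ (Set.range ![u, v]) with hM
  have hM2 : Module.finrank ℝ M = 2 := by
    rw [hM, finrank_span_eq_card hli, Fintype.card_fin]
  have hMn : Module.finrank ℝ M + Module.finrank ℝ Mᗮ = n := by
    rw [Submodule.finrank_add_finrank_orthogonal, finrank_euclideanSpace_fin]
  set T : E →ₗ[ℝ] (ℝ × ℝ) × Mᗮ :=
    ((innerₛₗ ℝ u).prod (innerₛₗ ℝ v)).prod Mᗮ.orthogonalProjectionOnto.toLinearMap with hT
  have hTa : ∀ w, T w = ((inner ℝ u w, inner ℝ v w), Mᗮ.orthogonalProjectionOnto w) := fun w => rfl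
  have hker : LinearMap.ker T = ⊥ := by
    refine LinearMap.ker_eq_bot'.2 fun w hw => ?_
    rw [hTa] at hw
    simp only [Prod.mk_eq_zero] at hw
    obtain ⟨⟨hw1, hw2⟩, hw3⟩ := hw
    have hwM : w ∈ Mᗮ := by
      rw [hM, Submodule.mem_orthogonal]
      intro x hx
      induction hx using Submodule.span_induction with
      | mem x hx =>
        obtain ⟨i, rfl⟩ := hx
        fin_cases i
        · exact hw1
        · exact hw2
      | zero => simp
      | add a b _ _ ha hb => rw [inner_add_left, ha, hb, add_zero]
      | smul a b _ hb => rw [inner_smul_left, hb, mul_zero]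
    have := congrArg Subtype.val hw3
    rwa [← Submodule.starProjection_apply, Submodule.starProjection_eq_self_iff.2 hwM] at this
  obtain ⟨K, hK0, hK⟩ := T.exists_antilipschitzWith hker
  have hK0' : (0 : ℝ) < K := hK0
  -- With this constant the two coordinates along `u` and `v`, multiplied by `K`, reach at most half
  -- of `‖y - z‖`, so the coordinate in `Mᗮ` must carry the antilipschitz bound.
  refine ⟨1 / (2 * K), by positivity, fun S hS => ?_⟩
  have hb : μHE[n - 1] ((id : E → E) '' S) ≤
      (K : ENNReal) ^ (n - 1) * μHE[n - 1] (Mᗮ.orthogonalProjectionOnto '' S) := by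
    refine euclideanHausdorffMeasure_image_le_image _ fun y hy z hz => ?_
    obtain ⟨ha, hb⟩ := hS y hy z hz
    have h := hK.le_mul_dist y z
    rw [dist_eq_norm, dist_eq_norm, ← map_sub, hTa, Prod.norm_def, Prod.norm_def] at h
    rw [id, id, edist_dist, edist_dist, dist_eq_norm, dist_eq_norm, ← map_sub,
      ← ENNReal.ofReal_coe_nnreal, ← ENNReal.ofReal_mul hK0'.le]
    refine ENNReal.ofReal_le_ofReal ?_
    by_contra hlt
    push Not at hlt
    have hKε : K * (1 / (2 * K) * ‖y - z‖) = ‖y - z‖ / 2 := by field_simp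
    have hp : 0 < ‖y - z‖ := lt_of_le_of_lt (by positivity) hlt
    have : (K : ℝ) * max (max ‖inner ℝ u (y - z)‖ ‖inner ℝ v (y - z)‖)
        ‖Mᗮ.orthogonalProjectionOnto (y - z)‖ < ‖y - z‖ := by
      rw [mul_max_of_nonneg _ _ hK0'.le, mul_max_of_nonneg _ _ hK0'.le]
      refine max_lt (max_lt ?_ ?_) hlt
      · calc K * ‖inner ℝ u (y - z)‖ ≤ K * (1 / (2 * K) * ‖y - z‖) := by gcongr; exact ha
          _ < _ := by rw [hKε]; linarith
      · calc K * ‖inner ℝ v (y - z)‖ ≤ K * (1 / (2 * K) * ‖y - z‖) := by gcongr; exact hb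
          _ < _ := by rw [hKε]; linarith
    exact absurd h (not_le.2 this)
  rw [image_id] at hb
  have h0 : (μHE[n - 1] : Measure Mᗮ) = 0 := by
    have hz : (μH[((n - 1 : ℕ) : ℝ)] : Measure Mᗮ) = 0 :=
      Real.hausdorffMeasure_of_finrank_lt
        (by exact_mod_cast (by omega : Module.finrank ℝ Mᗮ < n - 1))
    rw [Measure.euclideanHausdorffMeasure_def, hz, smul_zero]
  rw [h0] at hb
  simpa using hb

/-- The points at which two sets have linearly independent normals form a null set. -/
theorem euclideanHausdorffMeasure_independent_normals (A B : Set E) :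
    μHE[n - 1] {y | y ∈ A ∧ y ∈ B ∧ ∃ u v, IsOuterUnitNormal A y u ∧ IsOuterUnitNormal B y v ∧
      u ≠ v ∧ u ≠ -v} = 0 := by
  classical
  set Q : Set (E × E) := {p | ‖p.1‖ = 1 ∧ ‖p.2‖ = 1 ∧ p.1 ≠ p.2 ∧ p.1 ≠ -p.2} with hQ
  have hex : ∀ p ∈ Q, ∃ ε > 0, ∀ T : Set E,
      (∀ y ∈ T, ∀ z ∈ T, |inner ℝ p.1 (y - z)| ≤ ε * ‖y - z‖ ∧
        |inner ℝ p.2 (y - z)| ≤ ε * ‖y - z‖) → μHE[n - 1] T = 0 := fun p hp =>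
    exists_flatness_null hp.1 hp.2.1 hp.2.2.1 hp.2.2.2
  choose! ε hε hT using hex
  -- The flatness constant depends on the pair of normals, so `Q` is covered by balls of varying
  -- radius; second countability leaves countably many.
  obtain ⟨t, htQ, htc, hcov⟩ := TopologicalSpace.countable_cover_nhdsWithin (s := Q)
    (f := fun p => Metric.ball p (ε p)) fun p hp =>
      mem_nhdsWithin_of_mem_nhds (Metric.ball_mem_nhds p (hε p hp))
  refine measure_mono_null (t := ⋃ p ∈ t, {y | y ∈ A ∧ y ∈ B ∧ ∃ u v, IsOuterUnitNormal A y u ∧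
    IsOuterUnitNormal B y v ∧ (u, v) ∈ Metric.ball p (ε p)}) ?_ ?_
  · rintro y ⟨hA, hB, u, v, hu, hv, huv, huv'⟩
    obtain ⟨p, hp, hb⟩ := mem_iUnion₂.1 (hcov (show (u, v) ∈ Q from ⟨hu.1, hv.1, huv, huv'⟩))
    exact mem_iUnion₂.2 ⟨p, hp, hA, hB, u, v, hu, hv, hb⟩
  · refine (measure_biUnion_null_iff htc).2 fun p hp => hT p (htQ hp) _ ?_
    rintro y ⟨hA, hB, u, v, hu, hv, huv⟩ z ⟨hA', hB', u', v', hu', hv', huv'⟩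
    rw [Metric.mem_ball, Prod.dist_eq, max_lt_iff, dist_eq_norm, dist_eq_norm] at huv huv'
    exact ⟨abs_inner_sub_le_of_isOuterUnitNormal hA hA' hu hu' huv.1.le huv'.1.le,
      abs_inner_sub_le_of_isOuterUnitNormal hB hB' hv hv' huv.2.le huv'.2.le⟩

/-- Compare `L` with itself: two distinct normals at one point are not opposite, because `L` has
interior, and so are linearly independent. -/
theorem euclideanHausdorffMeasure_frontier_diff_regularBoundary (hL : Convex ℝ L)
    (hc : IsClosed L) (hint : (interior L).Nonempty) :
    μHE[n - 1] (frontier L \ regularBoundary L) = 0 := by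
  refine measure_mono_null ?_ (euclideanHausdorffMeasure_independent_normals L L)
  rintro y ⟨hy, hreg⟩
  obtain ⟨u, hu⟩ := exists_isOuterUnitNormal hL hint hy
  have : ∃ v, IsOuterUnitNormal L y v ∧ v ≠ u := by
    by_contra! h
    exact hreg ⟨hy, u, hu, h⟩
  obtain ⟨v, hv, hvu⟩ := this
  refine ⟨hc.frontier_subset hy, hc.frontier_subset hy, v, u, hv, hu, hvu, ?_⟩
  exact ne_neg_of_isOuterUnitNormal (by rwa [inter_self]) hv hu

theorem ae_surfaceMeasure_mem_regularBoundary (hL : Convex ℝ L)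
    (hc : IsClosed L) (hint : (interior L).Nonempty) :
    ∀ᵐ y ∂surfaceMeasure L, y ∈ regularBoundary L := by
  rw [surfaceMeasure, ae_restrict_iff' isClosed_frontier.measurableSet, ae_iff]
  convert euclideanHausdorffMeasure_frontier_diff_regularBoundary hL hc hint using 2
  ext y; simp

/-- On the points with a normal within `1 / 2` of `u`, the projection along `u` has a 2-Lipschitz
inverse and a bounded image. Finitely many such `u` suffice by compactness of the sphere. -/
theorem euclideanHausdorffMeasure_frontier_lt_top (hn : 1 ≤ n) (hL : Convex ℝ L)
    (hc : IsCompact L) (hint : (interior L).Nonempty) : μHE[n - 1] (frontier L) < ⊤ := by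
  have hfin : ∀ u ∈ Metric.sphere (0 : E) 1,
      μHE[n - 1] {y | y ∈ L ∧ ∃ v, IsOuterUnitNormal L y v ∧ v ∈ Metric.ball u (1 / 2)} < ⊤ := by
    intro u hu
    rw [mem_sphere_zero_iff_norm] at hu
    set T := {y | y ∈ L ∧ ∃ v, IsOuterUnitNormal L y v ∧ v ∈ Metric.ball u (1 / 2)} with hT
    have h1 : μHE[n - 1] ((id : E → E) '' T) ≤
        ((2 : NNReal) : ENNReal) ^ (n - 1) * μHE[n - 1] (perpProj u '' T) := by
      refine euclideanHausdorffMeasure_image_le_image _ ?_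
      rintro y ⟨hy, v, hv, hvu⟩ z ⟨hz, v', hv', hvu'⟩
      rw [Metric.mem_ball, dist_eq_norm] at hvu hvu'
      have h := abs_inner_sub_le_of_isOuterUnitNormal hy hz hv hv' hvu.le hvu'.le
      have h2 := norm_perpProj_sq hu (y - z)
      have h3 : inner ℝ u (y - z) ^ 2 ≤ (1 / 2 * ‖y - z‖) ^ 2 := by
        rw [← sq_abs]; gcongr
      rw [id, id, edist_dist, edist_dist, dist_eq_norm, dist_eq_norm, ← map_sub,
        ← ENNReal.ofReal_coe_nnreal, ← ENNReal.ofReal_mul (by simp)]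
      refine ENNReal.ofReal_le_ofReal (abs_le_of_sq_le_sq' ?_ (by positivity)).2
      rw [mul_pow, h2]
      push_cast
      nlinarith [sq_nonneg ‖y - z‖]
    rw [image_id] at h1
    refine h1.trans_lt (ENNReal.mul_lt_top (by simp) ?_)
    have hfr := finrank_perp hu (d := n - 1) (by rw [finrank_euclideanSpace_fin]; omega)
    have hvol : (μHE[n - 1] : Measure (Submodule.span ℝ {u})ᗮ) = volume := by
      rw [← InnerProductSpace.euclideanHausdorffMeasure_eq_volume, hfr]
    rw [hvol]
    refine lt_of_le_of_lt (measure_mono (image_mono fun y hy => hy.1)) ?_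
    exact (hc.image (perpProj u).continuous).measure_lt_top
  obtain ⟨t, ht, hcov⟩ := (isCompact_sphere (0 : E) 1).elim_nhds_subcover
    (fun u => Metric.ball u (1 / 2)) fun u _ => Metric.ball_mem_nhds u (by norm_num)
  refine lt_of_le_of_lt (measure_mono ?_) (measure_biUnion_lt_top t.finite_toSet
    fun u hu => hfin u (ht u hu))
  intro y hy
  obtain ⟨v, hv⟩ := exists_isOuterUnitNormal hL hint hy
  obtain ⟨u, hu, hb⟩ := mem_iUnion₂.1 (hcov (mem_sphere_zero_iff_norm.2 hv.1))
  exact mem_iUnion₂.2 ⟨u, hu, hc.isClosed.frontier_subset hy, v, hv, hb⟩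

theorem integrable_outerUnitNormal (hn : 1 ≤ n) (hL : Convex ℝ L)
    (hc : IsCompact L) (hint : (interior L).Nonempty) :
    Integrable (outerUnitNormal L) (surfaceMeasure L) := by
  have hfin : IsFiniteMeasure (surfaceMeasure L) := ⟨by
    rw [surfaceMeasure, Measure.restrict_apply_univ]
    exact euclideanHausdorffMeasure_frontier_lt_top hn hL hc hint⟩
  have hres : (surfaceMeasure L).restrict (regularBoundary L) = surfaceMeasure L :=
    Measure.restrict_eq_self_of_ae_mem (ae_surfaceMeasure_mem_regularBoundary hL hc.isClosed hint)
  refine Integrable.of_bound (C := 1) ?_ (.of_forall fun y => norm_outerUnitNormal_le L y)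
  rw [← hres]
  exact (continuousOn_outerUnitNormal L).aestronglyMeasurable (measurableSet_regularBoundary L)

end Normals

/-! ### Shadow area as an integral of the normal component -/

section ProjectionFormula

variable {n : ℕ} {L A : Set (EuclideanSpace ℝ (Fin n))} {e : EuclideanSpace ℝ (Fin n)}

local notation "E" => EuclideanSpace ℝ (Fin n)

/-- Of two points on one line in direction `e`, the higher would violate the support inequality at
the lower. -/
theorem injOn_perpProj_of_inner_outerUnitNormal_pos (hc : IsClosed L) (he : ‖e‖ = 1)
    (hA : A ⊆ regularBoundary L) (hpos : ∀ y ∈ A, 0 < inner ℝ (outerUnitNormal L y) e) :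
    InjOn (perpProj e) A := by
  have key : ∀ y ∈ A, ∀ z ∈ A, perpProj e y = perpProj e z → inner ℝ e y ≤ inner ℝ e z := by
    intro y hy z hz h
    by_contra! hlt
    have h1 := coe_perpProj he y
    rw [h, coe_perpProj he z] at h1
    have h2 : y - z = (inner ℝ e y - inner ℝ e z) • e := by
      rw [sub_smul]
      linear_combination (norm := module) -h1
    have h3 := (outerUnitNormal_spec (hA hz).2).2 y (hc.frontier_subset (hA hy).1)
    rw [h2, inner_smul_right] at h3
    have := mul_pos (sub_pos.2 hlt) (hpos z hz)
    linarith
  intro y hy z hz h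
  have h1 := coe_perpProj he y
  rw [h, coe_perpProj he z, le_antisymm (key y hy z hz h) (key z hz y hy h.symm)] at h1
  exact (sub_left_injective h1).symm

theorem measurableSet_inter_preimage_outerUnitNormal (hA : MeasurableSet A)
    (hAL : A ⊆ regularBoundary L) {U : Set E} (hU : IsOpen U) :
    MeasurableSet (A ∩ outerUnitNormal L ⁻¹' U) := by
  obtain ⟨W, hW, h⟩ := continuousOn_iff'.1 ((continuousOn_outerUnitNormal L).mono hAL) U hU
  rw [inter_comm, h]
  exact hW.measurableSet.inter hA

theorem ENNReal.le_of_forall_one_lt_mul_le {a b : ENNReal}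
    (h : ∀ η : ℝ, 1 < η → a ≤ ENNReal.ofReal η * b) : a ≤ b := by
  have ht : Filter.Tendsto (fun η : ℝ => ENNReal.ofReal η * b) (nhdsWithin 1 (Ioi 1))
      (nhds (ENNReal.ofReal 1 * b)) := by
    refine ENNReal.Tendsto.mul_const ?_ (Or.inl (by simp))
    exact ((ENNReal.continuous_ofReal).tendsto 1).mono_left nhdsWithin_le_nhds
  rw [ENNReal.ofReal_one, one_mul] at ht
  exact ge_of_tendsto ht (eventually_nhdsWithin_of_forall fun η hη => h η hη)

theorem exists_inner_comparison {u : E} (he : ‖e‖ = 1) (hue : 0 < inner ℝ u e) {η : ℝ}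
    (hη : 1 < η) : ∃ ε > 0, ∀ v : E, ‖v - u‖ ≤ ε →
      inner ℝ v e ≤ η * inner ℝ u e ∧ inner ℝ u e ≤ η * inner ℝ v e := by
  have hη0 : 0 < η := by linarith
  have hηi : 0 < 1 - η⁻¹ := by
    have := inv_lt_one_of_one_lt₀ hη
    linarith
  refine ⟨inner ℝ u e * (1 - η⁻¹), by positivity, fun v hv => ?_⟩
  have h := abs_real_inner_le_norm (v - u) e
  rw [he, mul_one] at h
  replace h := h.trans hv
  rw [inner_sub_left, abs_le] at h
  have h2 : 2 - η⁻¹ ≤ η := by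
    have : 0 ≤ (η - 1) ^ 2 * η⁻¹ := by positivity
    have : (η - 1) ^ 2 * η⁻¹ = η - 2 + η⁻¹ := by field_simp; ring
    linarith
  have hηη : η * η⁻¹ = 1 := mul_inv_cancel₀ hη0.ne'
  constructor
  · nlinarith
  · have h3 : inner ℝ u e * η⁻¹ ≤ inner ℝ v e := by linarith
    calc inner ℝ u e = η * (inner ℝ u e * η⁻¹) := by
          rw [mul_left_comm, hηη, mul_one]
      _ ≤ _ := by gcongr

/-- The surface integral of the positive normal component is the measure of the projection. -/
theorem setLIntegral_inner_outerUnitNormal (hn : 1 ≤ n) (hc : IsClosed L) (he : ‖e‖ = 1)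
    (hAm : MeasurableSet A) (hA : A ⊆ regularBoundary L)
    (hpos : ∀ y ∈ A, 0 < inner ℝ (outerUnitNormal L y) e) :
    ∫⁻ y in A, ENNReal.ofReal (inner ℝ (outerUnitNormal L y) e) ∂μHE[n - 1] =
      volume (perpProj e '' A) := by
  have hfin : Module.finrank ℝ E = n - 1 + 1 := by rw [finrank_euclideanSpace_fin]; omega
  have hvol : (volume : Measure (Submodule.span ℝ {e})ᗮ) = μHE[n - 1] := by
    rw [← InnerProductSpace.euclideanHausdorffMeasure_eq_volume, finrank_perp he hfin]
  rw [hvol]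
  rcases A.eq_empty_or_nonempty with rfl | ⟨y₀, hy₀⟩
  · simp
  have main : ∀ η : ℝ, 1 < η →
      ∫⁻ y in A, ENNReal.ofReal (inner ℝ (outerUnitNormal L y) e) ∂μHE[n - 1] ≤
        ENNReal.ofReal η * μHE[n - 1] (perpProj e '' A) ∧
      μHE[n - 1] (perpProj e '' A) ≤ ENNReal.ofReal η *
        ∫⁻ y in A, ENNReal.ofReal (inner ℝ (outerUnitNormal L y) e) ∂μHE[n - 1] := by
    intro η₂ hη₂
    -- One factor `η` pays for replacing the normal by a fixed `u` on a piece, the other for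
    -- treating the piece as flat.
    obtain ⟨η, hη, hηη⟩ := exists_one_lt_pow_le 2 hη₂
    have hη0 : 0 ≤ η := by linarith
    have hηη' : ENNReal.ofReal η * ENNReal.ofReal η ≤ ENNReal.ofReal η₂ := by
      rw [← ENNReal.ofReal_mul hη0, ← sq]
      exact ENNReal.ofReal_le_ofReal hηη
    set Q : Set E := {u | ‖u‖ = 1 ∧ 0 < inner ℝ u e} with hQ
    have hex : ∀ u ∈ Q, ∃ ε > 0, (∀ T : Set E,
        (∀ y ∈ T, ∀ z ∈ T, |inner ℝ u (y - z)| ≤ ε * ‖y - z‖) →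
        μHE[n - 1] (perpProj e '' T) ≤
          ENNReal.ofReal η * (ENNReal.ofReal (inner ℝ u e) * μHE[n - 1] T) ∧
        ENNReal.ofReal (inner ℝ u e) * μHE[n - 1] T ≤
          ENNReal.ofReal η * μHE[n - 1] (perpProj e '' T)) ∧
        ∀ v : E, ‖v - u‖ ≤ ε → inner ℝ v e ≤ η * inner ℝ u e ∧ inner ℝ u e ≤ η * inner ℝ v e := by
      rintro u ⟨hu, hue⟩
      obtain ⟨ε₁, hε₁, h₁⟩ := exists_flatness_perpProj hu he hue hfin hη
      obtain ⟨ε₂, hε₂, h₂⟩ := exists_inner_comparison he hue hη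
      refine ⟨min ε₁ ε₂, lt_min hε₁ hε₂, fun T hT => h₁ T fun y hy z hz => ?_,
        fun v hv => h₂ v (hv.trans (min_le_right _ _))⟩
      exact (hT y hy z hz).trans (by gcongr; exact min_le_left _ _)
    choose! ε hε hT using hex
    obtain ⟨t, htQ, htc, hcov⟩ := TopologicalSpace.countable_cover_nhdsWithin (s := Q)
      (f := fun p => Metric.ball p (ε p)) fun p hp =>
        mem_nhdsWithin_of_mem_nhds (Metric.ball_mem_nhds p (hε p hp))
    have hNQ : ∀ y ∈ A, outerUnitNormal L y ∈ Q := fun y hy =>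
      ⟨(outerUnitNormal_spec (hA hy).2).1, hpos y hy⟩
    have htn : t.Nonempty := by
      obtain ⟨p, hp, -⟩ := mem_iUnion₂.1 (hcov (hNQ y₀ hy₀))
      exact ⟨p, hp⟩
    obtain ⟨f, rfl⟩ := htc.exists_eq_range htn
    set B : ℕ → Set E := fun k => A ∩ outerUnitNormal L ⁻¹' Metric.ball (f k) (ε (f k)) with hB
    have hBm : ∀ k, MeasurableSet (B k) := fun k =>
      measurableSet_inter_preimage_outerUnitNormal hAm hA Metric.isOpen_ball
    have hBA : ⋃ k, B k = A := by
      refine subset_antisymm (iUnion_subset fun k => inter_subset_left) fun y hy => ?_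
      obtain ⟨p, ⟨k, rfl⟩, hp⟩ := mem_iUnion₂.1 (hcov (hNQ y hy))
      exact mem_iUnion.2 ⟨k, hy, hp⟩
    set D : ℕ → Set E := disjointed B with hD
    have hDm : ∀ k, MeasurableSet (D k) := fun k => MeasurableSet.disjointed hBm k
    have hDB : ∀ k, D k ⊆ B k := fun k => disjointed_subset B k
    have hDd : Pairwise (Function.onFun Disjoint D) := disjoint_disjointed B
    have hDA : ⋃ k, D k = A := by rw [hD, iUnion_disjointed, hBA]
    have hinj := injOn_perpProj_of_inner_outerUnitNormal_pos hc he hA hpos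
    have hDsub : ∀ k, D k ⊆ A := fun k => (hDB k).trans inter_subset_left
    have hI : ∫⁻ y in A, ENNReal.ofReal (inner ℝ (outerUnitNormal L y) e) ∂μHE[n - 1] =
        ∑' k, ∫⁻ y in D k, ENNReal.ofReal (inner ℝ (outerUnitNormal L y) e) ∂μHE[n - 1] := by
      rw [← lintegral_iUnion hDm hDd, hDA]
    -- Shadow areas add up only because the projection is injective on `A`, so that disjoint pieces
    -- have disjoint shadows.
    have hJ : μHE[n - 1] (perpProj e '' A) = ∑' k, μHE[n - 1] (perpProj e '' D k) := by
      rw [← measure_iUnion, ← image_iUnion, hDA]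
      · intro i j hij
        refine disjoint_left.2 ?_
        rintro _ ⟨y, hy, rfl⟩ ⟨z, hz, hzy⟩
        rw [hinj (hDsub j hz) (hDsub i hy) hzy] at hz
        exact disjoint_left.1 (hDd hij) hy hz
      · exact fun k => (hDm k).image_of_continuousOn_injOn (perpProj e).continuous.continuousOn
          (hinj.mono (hDsub k))
    have hpiece : ∀ k, ∫⁻ y in D k, ENNReal.ofReal (inner ℝ (outerUnitNormal L y) e) ∂μHE[n - 1] ≤
          ENNReal.ofReal η₂ * μHE[n - 1] (perpProj e '' D k) ∧
        μHE[n - 1] (perpProj e '' D k) ≤ ENNReal.ofReal η₂ *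
          ∫⁻ y in D k, ENNReal.ofReal (inner ℝ (outerUnitNormal L y) e) ∂μHE[n - 1] := by
      intro k
      obtain ⟨hT1, hT2⟩ := hT (f k) (htQ ⟨k, rfl⟩)
      have hnear : ∀ y ∈ D k, ‖outerUnitNormal L y - f k‖ ≤ ε (f k) := fun y hy => by
        have := (hDB k hy).2
        rw [mem_preimage, Metric.mem_ball, dist_eq_norm] at this
        exact this.le
      obtain ⟨h1, h2⟩ := hT1 (D k) fun y hy z hz =>
        abs_inner_sub_le_of_isOuterUnitNormal (hc.frontier_subset (hA (hDsub k hy)).1)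
          (hc.frontier_subset (hA (hDsub k hz)).1) (outerUnitNormal_spec (hA (hDsub k hy)).2)
          (outerUnitNormal_spec (hA (hDsub k hz)).2) (hnear y hy) (hnear z hz)
      constructor
      · calc ∫⁻ y in D k, ENNReal.ofReal (inner ℝ (outerUnitNormal L y) e) ∂μHE[n - 1]
            ≤ ∫⁻ y in D k, ENNReal.ofReal (η * inner ℝ (f k) e) ∂μHE[n - 1] :=
              setLIntegral_mono' (hDm k) fun y hy =>
                ENNReal.ofReal_le_ofReal (hT2 _ (hnear y hy)).1
          _ = ENNReal.ofReal η * (ENNReal.ofReal (inner ℝ (f k) e) * μHE[n - 1] (D k)) := by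
              rw [setLIntegral_const, ENNReal.ofReal_mul hη0, mul_assoc]
          _ ≤ ENNReal.ofReal η * (ENNReal.ofReal η * μHE[n - 1] (perpProj e '' D k)) := by gcongr
          _ ≤ _ := by rw [← mul_assoc]; gcongr
      · calc μHE[n - 1] (perpProj e '' D k)
            ≤ ENNReal.ofReal η * (ENNReal.ofReal (inner ℝ (f k) e) * μHE[n - 1] (D k)) := h1
          _ = ENNReal.ofReal η * ∫⁻ y in D k, ENNReal.ofReal (inner ℝ (f k) e) ∂μHE[n - 1] := by
              rw [setLIntegral_const]
          _ ≤ ENNReal.ofReal η * ∫⁻ y in D k, ENNReal.ofReal η *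
                ENNReal.ofReal (inner ℝ (outerUnitNormal L y) e) ∂μHE[n - 1] := by
              gcongr ENNReal.ofReal η * ?_
              refine setLIntegral_mono' (hDm k) fun y hy => ?_
              rw [← ENNReal.ofReal_mul hη0]
              exact ENNReal.ofReal_le_ofReal (hT2 _ (hnear y hy)).2
          _ = ENNReal.ofReal η * ENNReal.ofReal η *
                ∫⁻ y in D k, ENNReal.ofReal (inner ℝ (outerUnitNormal L y) e) ∂μHE[n - 1] := by
              rw [lintegral_const_mul' _ _ ENNReal.ofReal_ne_top, mul_assoc]
          _ ≤ _ := by gcongr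
    rw [hI, hJ, ← ENNReal.tsum_mul_left, ← ENNReal.tsum_mul_left]
    exact ⟨ENNReal.tsum_le_tsum fun k => (hpiece k).1, ENNReal.tsum_le_tsum fun k => (hpiece k).2⟩
  exact le_antisymm (ENNReal.le_of_forall_one_lt_mul_le fun η hη => (main η hη).1)
    (ENNReal.le_of_forall_one_lt_mul_le fun η hη => (main η hη).2)

end ProjectionFormula

/-! ### Overlap of a fixed and a moving interval -/

section Overlap

/-- The map `s ↦ min (max s c) d` clamps `s` to `[c, d]`, and the overlap runs between the clamped
endpoints. This treats the two moving ends separately. -/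
theorem volume_real_Icc_inter_Icc {a b c d : ℝ} (hab : a ≤ b) (hcd : c ≤ d) :
    volume.real (Icc c d ∩ Icc a b) = min (max b c) d - min (max a c) d := by
  rw [Icc_inter_Icc, Real.volume_real_Icc]
  grind

theorem abs_clamp_sub_clamp_le (c d x y : ℝ) :
    |min (max x c) d - min (max y c) d| ≤ |x - y| :=
  (abs_min_sub_min_le_max _ _ _ _).trans (by
    rw [sub_self, abs_zero, max_eq_left (abs_nonneg _)]
    refine (abs_max_sub_max_le_max _ _ _ _).trans ?_
    rw [sub_self, abs_zero, max_eq_left (abs_nonneg _)])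

theorem hasDerivAt_clamp {c d s : ℝ} (hcd : c ≤ d) (hc : s ≠ c) (hd : s ≠ d) :
    HasDerivAt (fun s : ℝ => min (max s c) d) (indicator (Icc c d) 1 s) s := by
  rcases lt_or_gt_of_ne hc with h | h
  · rw [indicator_of_notMem (fun h' => absurd h'.1 (not_le.2 h))]
    refine (hasDerivAt_const s c).congr_of_eventuallyEq ?_
    filter_upwards [Iio_mem_nhds h] with x hx
    rw [max_eq_right (le_of_lt hx), min_eq_left hcd]
  · rcases lt_or_gt_of_ne hd with h' | h'
    · rw [indicator_of_mem (s := Icc c d) ⟨h.le, h'.le⟩]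
      refine (hasDerivAt_id s).congr_of_eventuallyEq ?_
      filter_upwards [Ioo_mem_nhds h h'] with x hx
      rw [max_eq_left hx.1.le, min_eq_left hx.2.le, id]
    · rw [indicator_of_notMem (fun h'' => absurd h''.2 (not_le.2 h'))]
      refine (hasDerivAt_const s d).congr_of_eventuallyEq ?_
      filter_upwards [Ioi_mem_nhds h'] with x hx
      exact min_eq_right (le_max_of_le_left (le_of_lt hx))

theorem lipschitzWith_overlap {a b c d : ℝ} (hab : a ≤ b) (hcd : c ≤ d) :
    LipschitzWith 2 fun t => volume.real (Icc c d ∩ Icc (a + t) (b + t)) := by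
  refine LipschitzWith.of_dist_le_mul fun t t' => ?_
  rw [volume_real_Icc_inter_Icc (by linarith) hcd, volume_real_Icc_inter_Icc (by linarith) hcd,
    Real.dist_eq, Real.dist_eq]
  have h1 := abs_clamp_sub_clamp_le c d (b + t) (b + t')
  have h2 := abs_clamp_sub_clamp_le c d (a + t') (a + t)
  rw [add_sub_add_left_eq_sub] at h1 h2
  rw [abs_sub_comm t' t] at h2
  have h3 := abs_add_le (min (max (b + t) c) d - min (max (b + t') c) d)
    (min (max (a + t') c) d - min (max (a + t) c) d)
  rw [NNReal.coe_ofNat]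
  calc _ = _ := by congr 1; ring
    _ ≤ _ := h3
    _ ≤ _ := by linarith

theorem hasDerivAt_overlap {a b c d : ℝ} (hab : a ≤ b) (hcd : c ≤ d) (hac : a ≠ c) (had : a ≠ d)
    (hbc : b ≠ c) (hbd : b ≠ d) :
    HasDerivAt (fun t => volume.real (Icc c d ∩ Icc (a + t) (b + t)))
      (indicator (Icc c d) 1 b - indicator (Icc c d) 1 a) 0 := by
  have h : ∀ s : ℝ, s ≠ c → s ≠ d →
      HasDerivAt (fun t : ℝ => min (max (s + t) c) d) (indicator (Icc c d) 1 s) 0 := by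
    intro s hc hd
    have := HasDerivAt.comp_const_add (f := fun s : ℝ => min (max s c) d) s 0
      (by rw [add_zero]; exact hasDerivAt_clamp hcd hc hd)
    exact this
  refine ((h b hbc hbd).sub (h a hac had)).congr_of_eventuallyEq (.of_forall fun t => ?_)
  exact volume_real_Icc_inter_Icc (by linarith) hcd

end Overlap

/-! ### Slicing convex sets by parallel lines -/

section Slices

variable {V : Type*} [NormedAddCommGroup V] [InnerProductSpace ℝ V]

/-- The intersection of `A` with the line through `w` in direction `e`, parametrized by `ℝ`. -/
def lineSlice (e : V) (A : Set V) (w : (Submodule.span ℝ {e})ᗮ) : Set ℝ :=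
  {s | (w : V) + s • e ∈ A}

variable {e : V} {A : Set V} {w : (Submodule.span ℝ {e})ᗮ}

theorem continuous_line (e : V) (w : (Submodule.span ℝ {e})ᗮ) :
    Continuous fun s : ℝ => (w : V) + s • e := by fun_prop

theorem perpProj_line (he : ‖e‖ = 1) (w : (Submodule.span ℝ {e})ᗮ) (s : ℝ) :
    perpProj e ((w : V) + s • e) = w := by
  apply Subtype.ext
  have h : inner ℝ e (w : V) = 0 := Submodule.mem_orthogonal_singleton_iff_inner_right.1 w.2
  rw [coe_perpProj he, inner_add_right, inner_smul_right, h, real_inner_self_eq_norm_sq, he]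
  simp

theorem perpProj_add_inner_smul (he : ‖e‖ = 1) (y : V) :
    (perpProj e y : V) + inner ℝ e y • e = y := by
  rw [coe_perpProj he]; abel

theorem mem_image_perpProj_iff (he : ‖e‖ = 1) :
    w ∈ perpProj e '' A ↔ (lineSlice e A w).Nonempty := by
  constructor
  · rintro ⟨y, hy, rfl⟩
    exact ⟨inner ℝ e y, by rw [lineSlice, mem_ofPred_eq, perpProj_add_inner_smul he]; exact hy⟩
  · rintro ⟨s, hs⟩
    exact ⟨_, hs, perpProj_line he w s⟩

theorem lineSlice_eq_Icc (he : ‖e‖ = 1) (hc : IsCompact A) (hA : Convex ℝ A)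
    (hne : (lineSlice e A w).Nonempty) :
    ∃ a b, a ≤ b ∧ lineSlice e A w = Icc a b := by
  have hcl : IsClosed (lineSlice e A w) := hc.isClosed.preimage (continuous_line e w)
  have hbd : IsCompact (lineSlice e A w) := by
    refine (hc.image (innerSL ℝ e).continuous).of_isClosed_subset hcl fun s hs => ?_
    refine ⟨_, hs, ?_⟩
    have h : inner ℝ e (w : V) = 0 := Submodule.mem_orthogonal_singleton_iff_inner_right.1 w.2
    simp [inner_add_right, inner_smul_right, h, he]
  have hcv : Convex ℝ (lineSlice e A w) := by
    intro s hs t ht p q hp hq hpq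
    have := hA hs ht hp hq hpq
    change (w : V) + (p • s + q • t) • e ∈ A
    convert this using 1
    calc (w : V) + (p • s + q • t) • e = (p + q) • (w : V) + (p * s + q * t) • e := by
          rw [hpq, one_smul]; rfl
      _ = _ := by module
  have := eq_Icc_of_connected_compact ⟨hne, hcv.isPreconnected⟩ hbd
  refine ⟨_, _, ?_, this⟩
  rw [this] at hne
  exact nonempty_Icc.1 hne

theorem mem_frontier_of_lineSlice {a b s : ℝ} (h : lineSlice e A w = Icc a b)
    (hs : s = a ∨ s = b) (hab : a ≤ b) : (w : V) + s • e ∈ frontier A := by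
  have hmem : s ∈ lineSlice e A w := by
    rw [h]; rcases hs with rfl | rfl
    · exact left_mem_Icc.2 hab
    · exact right_mem_Icc.2 hab
  refine ⟨subset_closure hmem, fun hint => ?_⟩
  have : s ∈ interior (lineSlice e A w) :=
    preimage_interior_subset_interior_preimage (continuous_line e w) hint
  rw [h, interior_Icc] at this
  rcases hs with rfl | rfl
  · exact lt_irrefl _ this.1
  · exact lt_irrefl _ this.2

theorem lineSlice_inter_vadd (A B : Set V) (t : ℝ) {a b : ℝ} (hB : lineSlice e B w = Icc a b) :
    lineSlice e (A ∩ (t • e +ᵥ B)) w = lineSlice e A w ∩ Icc (a + t) (b + t) := by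
  ext s
  refine and_congr_right fun _ => ?_
  rw [mem_vadd_set_iff_neg_vadd_mem, vadd_eq_add]
  have : -(t • e) + ((w : V) + s • e) = (w : V) + (s - t) • e := by module
  rw [this]
  change s - t ∈ lineSlice e B w ↔ _
  rw [hB, mem_Icc, mem_Icc]
  constructor <;> rintro ⟨h1, h2⟩ <;> constructor <;> linarith

theorem lineSlice_inter_vadd_of_eq_empty (A B : Set V) (t : ℝ) (hB : lineSlice e B w = ∅) :
    lineSlice e (A ∩ (t • e +ᵥ B)) w = ∅ := by
  refine eq_empty_of_forall_notMem fun s hs => ?_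
  have := hs.2
  rw [mem_vadd_set_iff_neg_vadd_mem, vadd_eq_add] at this
  have h : -(t • e) + ((w : V) + s • e) = (w : V) + (s - t) • e := by module
  rw [h] at this
  exact absurd (show s - t ∈ lineSlice e B w from this) (by simp [hB])

/-- Every line over the interior of the projection meets the interior. -/
theorem exists_mem_interior_of_mem_interior_image (hA : Convex ℝ A) (he : ‖e‖ = 1)
    (hint : (interior A).Nonempty) (hw : w ∈ interior (perpProj e '' A)) :
    ∃ s : ℝ, (w : V) + s • e ∈ interior A := by
  obtain ⟨x₀, hx₀⟩ := hint
  have hc : Filter.Tendsto (fun t : ℝ => w + t • (w - perpProj e x₀)) (nhdsWithin 0 (Ioi 0))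
      (nhds w) := by
    have : Continuous fun t : ℝ => w + t • (w - perpProj e x₀) := by fun_prop
    have := (this.tendsto 0).mono_left (nhdsWithin_le_nhds (s := Ioi 0))
    simpa using this
  obtain ⟨t, ⟨z, hz, hzt⟩, ht0⟩ := ((hc.eventually (mem_interior_iff_mem_nhds.1 hw)).and
    self_mem_nhdsWithin).exists
  have ht0 : 0 < t := ht0
  have ht1 : 0 < 1 + t := by linarith
  -- The weights solve for the point over `w` on the segment from `x₀` to `z`, where `z` lies over
  -- the point slightly beyond `w` as seen from the shadow of `x₀`.
  set x := (t / (1 + t)) • x₀ + (1 / (1 + t)) • z with hx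
  have hxi : x ∈ interior A :=
    hA.combo_interior_self_mem_interior hx₀ hz (by positivity) (by positivity)
      (by field_simp; ring)
  have hpx : perpProj e x = w := by
    rw [hx, map_add, map_smul, map_smul, hzt]
    have : (w : (Submodule.span ℝ {e})ᗮ) = ((1 / (1 + t)) * (1 + t)) • w := by
      rw [one_div, inv_mul_cancel₀ ht1.ne', one_smul]
    conv_rhs => rw [this]
    have h2 : t / (1 + t) = (1 / (1 + t)) * t := by ring
    rw [h2]
    module
  refine ⟨inner ℝ e x, ?_⟩
  rw [← hpx, perpProj_add_inner_smul he]
  exact hxi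

variable [FiniteDimensional ℝ V] [MeasurableSpace V] [BorelSpace V]

theorem measurePreserving_line (he : ‖e‖ = 1) :
    MeasurePreserving (fun p : (Submodule.span ℝ {e})ᗮ × ℝ => (p.1 : V) + p.2 • e) := by
  have h1 : MeasurePreserving (LinearIsometryEquiv.toSpanUnitSingleton (𝕜 := ℝ) e he) :=
    LinearIsometryEquiv.measurePreserving _
  have h2 := ((Submodule.span ℝ {e}).measurePreserving_measurableEquivProd (0 : V)).symm
  rw [InnerProductSpace.euclideanHausdorffMeasure_eq_volume] at h2
  have h3 := h2.comp ((h1.prod (MeasurePreserving.id (volume : Measure (Submodule.span ℝ {e})ᗮ))).comp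
    (Measure.measurePreserving_swap (μ := (volume : Measure (Submodule.span ℝ {e})ᗮ))
      (ν := (volume : Measure ℝ))))
  refine (congrArg (fun f => MeasurePreserving f _ _) (funext fun p => ?_)).mpr h3
  simp [add_comm]

theorem volume_eq_lintegral_lineSlice (he : ‖e‖ = 1) (hA : MeasurableSet A) :
    volume A = ∫⁻ w, volume (lineSlice e A w) := by
  rw [← (measurePreserving_line he).measure_preimage hA.nullMeasurableSet, Measure.volume_eq_prod,
    Measure.prod_apply ((measurePreserving_line he).measurable hA)]
  rfl

theorem measurable_volume_lineSlice (he : ‖e‖ = 1) (hA : MeasurableSet A) :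
    Measurable fun w => volume (lineSlice e A w) :=
  measurable_measure_prodMk_left ((measurePreserving_line he).measurable hA)

theorem integrable_volume_lineSlice (he : ‖e‖ = 1) (hA : MeasurableSet A) (hfin : volume A ≠ ⊤) :
    Integrable fun w => volume.real (lineSlice e A w) := by
  refine integrable_toReal_of_lintegral_ne_top (measurable_volume_lineSlice he hA).aemeasurable ?_
  rwa [← volume_eq_lintegral_lineSlice he hA]

theorem volume_real_eq_integral_lineSlice (he : ‖e‖ = 1) (hA : MeasurableSet A)
    (hfin : volume A ≠ ⊤) : volume.real A = ∫ w, volume.real (lineSlice e A w) := by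
  have hf : ∀ᵐ w, volume (lineSlice e A w) < ⊤ :=
    ae_lt_top (measurable_volume_lineSlice he hA) (by rwa [← volume_eq_lintegral_lineSlice he hA])
  rw [measureReal_def, volume_eq_lintegral_lineSlice he hA]
  exact (integral_toReal (measurable_volume_lineSlice he hA).aemeasurable hf).symm

end Slices

/-! ### Derivative of the overlap volume of two convex bodies -/

section Derivative

variable {n : ℕ} {A B : Set (EuclideanSpace ℝ (Fin n))} {e : EuclideanSpace ℝ (Fin n)}

local notation "E" => EuclideanSpace ℝ (Fin n)

theorem volume_perp_eq_euclideanHausdorffMeasure (hn : 1 ≤ n) (he : ‖e‖ = 1) :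
    (volume : Measure (Submodule.span ℝ {e})ᗮ) = μHE[n - 1] := by
  rw [← InnerProductSpace.euclideanHausdorffMeasure_eq_volume,
    finrank_perp he (d := n - 1) (by rw [finrank_euclideanSpace_fin]; omega)]

theorem volume_image_perpProj_le (hn : 1 ≤ n) (he : ‖e‖ = 1) (A : Set E) :
    volume (perpProj e '' A) ≤ μHE[n - 1] A := by
  rw [volume_perp_eq_euclideanHausdorffMeasure hn he]
  exact euclideanHausdorffMeasure_perpProj_le e (n - 1) A

/-- The hyperplanes of `e` and `-e` coincide but are different types, so the shadows are compared as
subsets of the ambient space. -/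
theorem volume_image_perpProj_neg (hn : 1 ≤ n) (he : ‖e‖ = 1) (A : Set E) :
    volume (perpProj (-e) '' A) = volume (perpProj e '' A) := by
  have he' : ‖-e‖ = 1 := by rwa [norm_neg]
  rw [volume_perp_eq_euclideanHausdorffMeasure hn he,
    volume_perp_eq_euclideanHausdorffMeasure hn he',
    ← (isometry_subtype_coe (s := ((Submodule.span ℝ {e})ᗮ : Set E))).euclideanHausdorffMeasure_image,
    ← (isometry_subtype_coe (s := ((Submodule.span ℝ {-e})ᗮ : Set E))).euclideanHausdorffMeasure_image,
    image_image, image_image]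
  congr 1
  refine image_congr fun y _ => ?_
  change (perpProj (-e) y : E) = (perpProj e y : E)
  rw [coe_perpProj he, coe_perpProj he', inner_neg_left, neg_smul_neg]

/-- The points of `A` on the boundary of `B` at which the outer unit normal of `B` has positive
component in direction `e`. -/
def upperPart (A B : Set E) (e : E) : Set E :=
  A ∩ regularBoundary B ∩ {y | 0 < inner ℝ (outerUnitNormal B y) e}

theorem measurableSet_upperPart (hA : MeasurableSet A) (B : Set E) (e : E) :
    MeasurableSet (upperPart A B e) :=
  measurableSet_inter_preimage_outerUnitNormal (U := {v | 0 < inner ℝ v e})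
    (hA.inter (measurableSet_regularBoundary B)) inter_subset_right
    (isOpen_lt continuous_const (by fun_prop))

theorem upperPart_subset (A B : Set E) (e : E) : upperPart A B e ⊆ regularBoundary B :=
  fun _ hy => hy.1.2

theorem setLIntegral_ofReal_inner (hn : 1 ≤ n) (hA : MeasurableSet A) (hc : IsClosed B)
    (he : ‖e‖ = 1) :
    ∫⁻ y in A ∩ regularBoundary B, ENNReal.ofReal (inner ℝ (outerUnitNormal B y) e) ∂μHE[n - 1] =
      volume (perpProj e '' upperPart A B e) := by
  rw [← setLIntegral_inner_outerUnitNormal hn hc he (measurableSet_upperPart hA B e)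
    (upperPart_subset A B e) fun y hy => hy.2]
  have hsub : upperPart A B e ⊆ A ∩ regularBoundary B := inter_subset_left
  rw [← lintegral_inter_add_sdiff _ (A ∩ regularBoundary B) (measurableSet_upperPart hA B e),
    inter_eq_self_of_subset_right hsub]
  convert add_zero _
  refine (setLIntegral_congr_fun ((hA.inter (measurableSet_regularBoundary B)).diff
    (measurableSet_upperPart hA B e)) (g := fun _ => 0) fun y hy => ?_).trans (by simp)
  refine ENNReal.ofReal_eq_zero.2 (not_lt.1 fun h => hy.2 ⟨hy.1, h⟩)

theorem upperPart_subset_of_isClosed (hc : IsClosed B) : upperPart A B e ⊆ B :=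
  fun _ hy => hc.frontier_subset hy.1.2.1

theorem volume_image_upperPart_lt_top (hB : IsCompact B) :
    volume (perpProj e '' upperPart A B e) < ⊤ :=
  lt_of_le_of_lt (measure_mono (image_mono (upperPart_subset_of_isClosed hB.isClosed)))
    (hB.image (perpProj e).continuous).measure_lt_top

/-- The surface integral of a component of the normal, in terms of projections. -/
theorem setIntegral_inner_surfaceMeasure (hn : 1 ≤ n) (hA : MeasurableSet A) (hB : IsCompact B)
    (hBc : Convex ℝ B) (hint : (interior B).Nonempty) (he : ‖e‖ = 1) :
    ∫ y in A, inner ℝ (outerUnitNormal B y) e ∂surfaceMeasure B =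
      volume.real (perpProj e '' upperPart A B e) -
        volume.real (perpProj e '' upperPart A B (-e)) := by
  have he' : ‖-e‖ = 1 := by rwa [norm_neg]
  have hI : Integrable (fun y => inner ℝ (outerUnitNormal B y) e) (surfaceMeasure B) :=
    (integrable_outerUnitNormal hn hBc hB hint).inner_const e
  have hres : (surfaceMeasure B).restrict A = μHE[n - 1].restrict (A ∩ regularBoundary B) := by
    rw [surfaceMeasure, Measure.restrict_restrict hA]
    refine Measure.restrict_congr_set ?_
    have h0 := euclideanHausdorffMeasure_frontier_diff_regularBoundary hBc hB.isClosed hint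
    refine Filter.EventuallyEq.inter (by rfl) (Filter.EventuallyLE.antisymm ?_ ?_)
    · exact ae_le_set.2 h0
    · exact Filter.Eventually.of_forall fun y hy => hy.1
  rw [integral_eq_lintegral_pos_part_sub_lintegral_neg_part hI.integrableOn, hres,
    setLIntegral_ofReal_inner hn hA hB.isClosed he]
  simp only [← inner_neg_right]
  rw [setLIntegral_ofReal_inner hn hA hB.isClosed he', volume_image_perpProj_neg hn he]
  rfl

/-- Over `w`, a point whose normal has positive `e`-component can only be the upper end of the slice
of `B`; any higher point of `B` would violate the support inequality. -/
theorem mem_image_upperPart_iff {w : (Submodule.span ℝ {e})ᗮ} (he : ‖e‖ = 1) (hc : IsClosed B)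
    {a b : ℝ} (hab : a ≤ b) (hs : lineSlice e B w = Icc a b)
    (hreg : ((w : E) + b • e) ∈ regularBoundary B)
    (hpos : 0 < inner ℝ (outerUnitNormal B ((w : E) + b • e)) e) :
    w ∈ perpProj e '' upperPart A B e ↔ b ∈ lineSlice e A w := by
  constructor
  · rintro ⟨y, hy, rfl⟩
    have hyB := upperPart_subset_of_isClosed hc hy
    have hyb : inner ℝ e y ∈ lineSlice e B (perpProj e y) := by
      rw [lineSlice, mem_ofPred_eq, perpProj_add_inner_smul he]; exact hyB
    have hyA : inner ℝ e y ∈ lineSlice e A (perpProj e y) := by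
      rw [lineSlice, mem_ofPred_eq, perpProj_add_inner_smul he]; exact hy.1.1
    rw [hs] at hyb
    have hb : ((perpProj e y : E) + b • e) ∈ B := by
      have : b ∈ lineSlice e B (perpProj e y) := by rw [hs]; exact right_mem_Icc.2 hab
      exact this
    have h := (outerUnitNormal_spec hy.1.2.2).2 _ hb
    have hyb' : (perpProj e y : E) + b • e - y = (b - inner ℝ e y) • e := by
      rw [coe_perpProj he]; module
    rw [hyb', inner_smul_right] at h
    have hpos' := hy.2
    have : b = inner ℝ e y := by
      refine le_antisymm ?_ hyb.2
      by_contra! hlt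
      have := mul_pos (sub_pos.2 hlt) hpos'
      linarith
    rw [this]
    exact hyA
  · intro hb
    exact ⟨_, ⟨⟨hb, hreg⟩, hpos⟩, perpProj_line he w b⟩

theorem mem_image_upperPart_neg_iff {w : (Submodule.span ℝ {e})ᗮ} (he : ‖e‖ = 1) (hc : IsClosed B)
    {a b : ℝ} (hab : a ≤ b) (hs : lineSlice e B w = Icc a b)
    (hreg : ((w : E) + a • e) ∈ regularBoundary B)
    (hneg : inner ℝ (outerUnitNormal B ((w : E) + a • e)) e < 0) :
    w ∈ perpProj e '' upperPart A B (-e) ↔ a ∈ lineSlice e A w := by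
  constructor
  · rintro ⟨y, hy, rfl⟩
    have hyB := upperPart_subset_of_isClosed hc hy
    have hya : inner ℝ e y ∈ lineSlice e B (perpProj e y) := by
      rw [lineSlice, mem_ofPred_eq, perpProj_add_inner_smul he]; exact hyB
    have hyA : inner ℝ e y ∈ lineSlice e A (perpProj e y) := by
      rw [lineSlice, mem_ofPred_eq, perpProj_add_inner_smul he]; exact hy.1.1
    rw [hs] at hya
    have ha : ((perpProj e y : E) + a • e) ∈ B := by
      have : a ∈ lineSlice e B (perpProj e y) := by rw [hs]; exact left_mem_Icc.2 hab
      exact this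
    have h := (outerUnitNormal_spec hy.1.2.2).2 _ ha
    have hya' : (perpProj e y : E) + a • e - y = (inner ℝ e y - a) • (-e) := by
      rw [coe_perpProj he]; module
    rw [hya', inner_smul_right] at h
    have hpos' := hy.2
    have : a = inner ℝ e y := by
      refine le_antisymm hya.1 ?_
      by_contra! hlt
      have := mul_pos (sub_pos.2 hlt) hpos'
      linarith
    rw [this]
    exact hyA
  · intro ha
    refine ⟨_, ⟨⟨ha, hreg⟩, ?_⟩, perpProj_line he w a⟩
    change 0 < inner ℝ (outerUnitNormal B ((w : E) + a • e)) (-e)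
    rw [inner_neg_right]
    linarith

/-- The derivative of the overlap of `A` with the translates of `B` in direction `e`. -/
theorem hasDerivAt_volume_inter_vadd (hn : 1 ≤ n) (hA : IsCompact A) (hAc : Convex ℝ A)
    (hB : IsCompact B) (hBc : Convex ℝ B) (hint : (interior B).Nonempty)
    (hnull : μHE[n - 1] (frontier A ∩ frontier B) = 0) (he : ‖e‖ = 1) :
    HasDerivAt (fun t : ℝ => volume.real (A ∩ (t • e +ᵥ B)))
      (∫ y in A, inner ℝ (outerUnitNormal B y) e ∂surfaceMeasure B) 0 := by
  classical
  set P := perpProj e with hP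
  set U₁ := P '' upperPart A B e with hU₁
  set U₂ := P '' upperPart A B (-e) with hU₂
  have hAm := hA.isClosed.measurableSet
  have he' : ‖-e‖ = 1 := by rwa [norm_neg]
  have hU₁m : MeasurableSet U₁ :=
    (measurableSet_upperPart hAm B e).image_of_continuousOn_injOn P.continuous.continuousOn
      (injOn_perpProj_of_inner_outerUnitNormal_pos hB.isClosed he (upperPart_subset A B e)
        fun y hy => hy.2)
  have hU₂m : MeasurableSet U₂ := by
    refine (measurableSet_upperPart hAm B (-e)).image_of_continuousOn_injOn
      P.continuous.continuousOn ?_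
    have := injOn_perpProj_of_inner_outerUnitNormal_pos hB.isClosed he'
      (upperPart_subset A B (-e)) fun y hy => hy.2
    intro y hy z hz hyz
    refine this hy hz (Subtype.ext ?_)
    have hyz' := congrArg Subtype.val hyz
    rw [coe_perpProj he, coe_perpProj he] at hyz'
    rw [coe_perpProj he', coe_perpProj he', inner_neg_left, inner_neg_left, neg_smul_neg,
      neg_smul_neg, hyz']
  have hPB : IsCompact (P '' B) := hB.image P.continuous
  have hcpt : ∀ t : ℝ, IsCompact (A ∩ (t • e +ᵥ B)) := fun t =>
    hA.inter_right (hB.vadd (t • e)).isClosed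
  have hF : (fun t : ℝ => volume.real (A ∩ (t • e +ᵥ B))) =
      fun t => ∫ w, volume.real (lineSlice e (A ∩ (t • e +ᵥ B)) w) := funext fun t =>
    volume_real_eq_integral_lineSlice he (hcpt t).isClosed.measurableSet
      (hcpt t).measure_lt_top.ne
  set F' : (Submodule.span ℝ {e})ᗮ → ℝ := fun w => indicator U₁ 1 w - indicator U₂ 1 w with hF'
  have hint' : ∫ w, F' w = ∫ y in A, inner ℝ (outerUnitNormal B y) e ∂surfaceMeasure B := by
    rw [setIntegral_inner_surfaceMeasure hn hAm hB hBc hint he, hF', integral_sub,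
      integral_indicator_one hU₁m, integral_indicator_one hU₂m]
    · exact (integrable_indicator_iff hU₁m).2
        (integrableOn_const (volume_image_upperPart_lt_top hB).ne)
    · refine (integrable_indicator_iff hU₂m).2 (integrableOn_const ?_)
      exact (lt_of_le_of_lt (measure_mono (image_mono
        (upperPart_subset_of_isClosed hB.isClosed))) hPB.measure_lt_top).ne
  rw [hF, ← hint']
  -- The slice lengths are 2-Lipschitz in `t` and vanish off the compact shadow of `B`, which
  -- provides an integrable bound.
  refine (hasDerivAt_integral_of_dominated_loc_of_lip (F := fun (t : ℝ) w =>
    volume.real (lineSlice e (A ∩ (t • e +ᵥ B)) w)) (s := univ)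
    (bound := indicator (P '' B) fun _ => 2) Filter.univ_mem ?_ ?_ ?_ ?_ ?_ ?_).2
  · exact .of_forall fun t => (integrable_volume_lineSlice he (hcpt t).isClosed.measurableSet
      (hcpt t).measure_lt_top.ne).aestronglyMeasurable
  · exact integrable_volume_lineSlice he (hcpt 0).isClosed.measurableSet
      (hcpt 0).measure_lt_top.ne
  · exact ((measurable_one.indicator hU₁m).sub
      (measurable_one.indicator hU₂m)).aestronglyMeasurable
  · refine .of_forall fun w => LipschitzWith.lipschitzOnWith ?_
    by_cases hw : w ∈ P '' B
    · obtain ⟨a, b, hab, hs⟩ := lineSlice_eq_Icc he hB hBc ((mem_image_perpProj_iff he).1 hw)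
      have hnn : Real.nnabs (indicator (P '' B) (fun _ => (2 : ℝ)) w) = 2 := by
        rw [indicator_of_mem hw]
        ext; simp
      rw [hnn]
      simp only [lineSlice_inter_vadd A B _ hs]
      rcases (lineSlice e A w).eq_empty_or_nonempty with h0 | hne
      · simp only [h0, empty_inter, measureReal_empty]
        exact (LipschitzWith.const 0).weaken (by simp)
      · obtain ⟨c, d, hcd, hs'⟩ := lineSlice_eq_Icc he hA hAc hne
        rw [hs']
        exact lipschitzWith_overlap hab hcd
    · have h0 : lineSlice e B w = ∅ :=
        not_nonempty_iff_eq_empty.1 fun h => hw ((mem_image_perpProj_iff he).2 h)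
      simp only [lineSlice_inter_vadd_of_eq_empty A B _ h0, measureReal_empty]
      exact (LipschitzWith.const 0).weaken (by simp)
  · exact (integrable_indicator_iff hPB.isClosed.measurableSet).2
      (integrableOn_const hPB.measure_lt_top.ne)
  -- Three null sets of lines are discarded: those through common boundary points of `A` and `B`,
  -- those through singular boundary points of `B`, and those over the boundary of the shadow. Every
  -- other line that meets `B` also meets its interior, so the normals at the two ends have strict
  -- signs.
  · have hz₁ : volume (P '' (frontier A ∩ frontier B)) = 0 :=
      le_antisymm ((volume_image_perpProj_le hn he _).trans hnull.le) zero_le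
    have hz₂ : volume (P '' (frontier B \ regularBoundary B)) = 0 :=
      le_antisymm ((volume_image_perpProj_le hn he _).trans
        (euclideanHausdorffMeasure_frontier_diff_regularBoundary hBc hB.isClosed hint).le) zero_le
    have hz₃ : volume (frontier (P '' B)) = 0 :=
      (hBc.is_linear_image P.toLinearMap.isLinear).addHaar_frontier volume
    filter_upwards [measure_eq_zero_iff_ae_notMem.1 hz₁, measure_eq_zero_iff_ae_notMem.1 hz₂,
      measure_eq_zero_iff_ae_notMem.1 hz₃] with w hw₁ hw₂ hw₃
    by_cases hw : w ∈ P '' B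
    · obtain ⟨a, b, hab, hs⟩ := lineSlice_eq_Icc he hB hBc ((mem_image_perpProj_iff he).1 hw)
      have hwi : w ∈ interior (P '' B) := by
        by_contra h
        exact hw₃ ⟨subset_closure hw, h⟩
      obtain ⟨s, hsi⟩ := exists_mem_interior_of_mem_interior_image hBc he hint hwi
      have hsB : (w : E) + s • e ∈ B := interior_subset hsi
      have hsab : s ∈ Icc a b := hs ▸ (show s ∈ lineSlice e B w from hsB)
      have hfa : (w : E) + a • e ∈ frontier B := mem_frontier_of_lineSlice hs (Or.inl rfl) hab
      have hfb : (w : E) + b • e ∈ frontier B := mem_frontier_of_lineSlice hs (Or.inr rfl) hab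
      have hreg : ∀ r : ℝ, (w : E) + r • e ∈ frontier B → (w : E) + r • e ∈ regularBoundary B :=
        fun r hr => by_contra fun h => hw₂ ⟨_, ⟨hr, h⟩, perpProj_line he w r⟩
      have hin : ∀ r : ℝ, (w : E) + r • e ∈ frontier B →
          (s - r) * inner ℝ (outerUnitNormal B ((w : E) + r • e)) e < 0 := fun r hr => by
        have := (outerUnitNormal_spec (hreg r hr).2).inner_neg_of_mem_interior hsi
        rwa [add_sub_add_left_eq_sub, ← sub_smul, inner_smul_right] at this
      have hpos : 0 < inner ℝ (outerUnitNormal B ((w : E) + b • e)) e := by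
        have := hin b hfb
        by_contra! h
        have := mul_nonneg_of_nonpos_of_nonpos (sub_nonpos.2 hsab.2) h
        linarith
      have hneg : inner ℝ (outerUnitNormal B ((w : E) + a • e)) e < 0 := by
        have := hin a hfa
        by_contra! h
        have := mul_nonneg (sub_nonneg.2 hsab.1) h
        linarith
      have hi₁ : indicator U₁ (1 : (Submodule.span ℝ {e})ᗮ → ℝ) w = indicator (lineSlice e A w) 1 b := by
        have := mem_image_upperPart_iff (A := A) he hB.isClosed hab hs (hreg b hfb) hpos
        simp only [indicator_apply, Pi.one_apply]
        exact if_congr this rfl rfl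
      have hi₂ : indicator U₂ (1 : (Submodule.span ℝ {e})ᗮ → ℝ) w = indicator (lineSlice e A w) 1 a := by
        have := mem_image_upperPart_neg_iff (A := A) he hB.isClosed hab hs (hreg a hfa) hneg
        simp only [indicator_apply, Pi.one_apply]
        exact if_congr this rfl rfl
      simp only [hF', hi₁, hi₂, lineSlice_inter_vadd A B _ hs]
      rcases (lineSlice e A w).eq_empty_or_nonempty with h0 | hne
      · simp only [h0, empty_inter, measureReal_empty, indicator_empty, sub_self]
        exact hasDerivAt_const _ _
      · obtain ⟨c, d, hcd, hs'⟩ := lineSlice_eq_Icc he hA hAc hne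
        rw [hs']
        have hdis : ∀ r q : ℝ, (w : E) + r • e ∈ frontier B → (w : E) + q • e ∈ frontier A →
            r ≠ q := by
          rintro r _ hr hq rfl
          exact hw₁ ⟨_, ⟨hq, hr⟩, perpProj_line he w r⟩
        have hfc := mem_frontier_of_lineSlice hs' (Or.inl rfl) hcd
        have hfd := mem_frontier_of_lineSlice hs' (Or.inr rfl) hcd
        exact hasDerivAt_overlap hab hcd (hdis _ _ hfa hfc) (hdis _ _ hfa hfd)
          (hdis _ _ hfb hfc) (hdis _ _ hfb hfd)
    · have h0 : lineSlice e B w = ∅ :=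
        not_nonempty_iff_eq_empty.1 fun h => hw ((mem_image_perpProj_iff he).2 h)
      have hU : ∀ v : E, w ∉ P '' upperPart A B v := fun v h =>
        hw (image_mono (upperPart_subset_of_isClosed hB.isClosed) h)
      simp only [lineSlice_inter_vadd_of_eq_empty A B _ h0, measureReal_empty, hF', hU₁, hU₂,
        indicator_of_notMem (hU _), sub_self]
      exact hasDerivAt_const _ _

end Derivative

/-! ### Homothetic copies of a strictly convex body -/

section Homothets

variable {n : ℕ} {K L : Set (EuclideanSpace ℝ (Fin n))} {τ : ℝ}
  {x y z u v e : EuclideanSpace ℝ (Fin n)}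

local notation "E" => EuclideanSpace ℝ (Fin n)

theorem mem_vadd_smul_iff (hτ : 0 < τ) : y ∈ x +ᵥ τ • K ↔ τ⁻¹ • (y - x) ∈ K := by
  rw [mem_vadd_set_iff_neg_vadd_mem, mem_smul_set_iff_inv_smul_mem₀ hτ.ne', vadd_eq_add,
    neg_add_eq_sub]

theorem isCompact_vadd_smul (hK : IsCompact K) (x : E) (τ : ℝ) : IsCompact (x +ᵥ τ • K) :=
  (hK.smul τ).vadd x

theorem convex_vadd_smul (hK : Convex ℝ K) (x : E) (τ : ℝ) : Convex ℝ (x +ᵥ τ • K) :=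
  (hK.smul τ).vadd x

theorem interior_vadd_smul_nonempty (hK : (interior K).Nonempty) (hτ : 0 < τ) (x : E) :
    (interior (x +ᵥ τ • K)).Nonempty := by
  have h : (interior (τ • K)).Nonempty := by
    rw [interior_smul₀ hτ.ne']
    exact hK.smul_set
  rw [interior_vadd]
  exact h.vadd_set

theorem IsOuterUnitNormal.of_vadd_smul (hτ : 0 < τ) (h : IsOuterUnitNormal (x +ᵥ τ • K) y u) :
    IsOuterUnitNormal K (τ⁻¹ • (y - x)) u := by
  refine ⟨h.1, fun z hz => ?_⟩
  have h1 := h.2 (x + τ • z) (by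
    rw [mem_vadd_smul_iff hτ, add_sub_cancel_left, smul_smul, inv_mul_cancel₀ hτ.ne', one_smul]
    exact hz)
  have h2 : z - τ⁻¹ • (y - x) = τ⁻¹ • (x + τ • z - y) := by
    have : z = τ⁻¹ • (τ • z) := by rw [smul_smul, inv_mul_cancel₀ hτ.ne', one_smul]
    conv_lhs => rw [this]
    module
  rw [h2, inner_smul_right]
  exact mul_nonpos_of_nonneg_of_nonpos (by positivity) h1

theorem IsOuterUnitNormal.vadd (h : IsOuterUnitNormal L y u) (x : E) :
    IsOuterUnitNormal (x +ᵥ L) (x + y) u := by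
  refine ⟨h.1, fun z hz => ?_⟩
  rw [mem_vadd_set_iff_neg_vadd_mem, vadd_eq_add] at hz
  have := h.2 _ hz
  rwa [show z - (x + y) = -x + z - y by abel]

theorem isOuterUnitNormal_vadd_iff (x : E) :
    IsOuterUnitNormal (x +ᵥ L) (x + y) u ↔ IsOuterUnitNormal L y u := by
  refine ⟨fun h => ?_, fun h => h.vadd x⟩
  have := h.vadd (-x)
  rwa [neg_vadd_vadd, neg_add_cancel_left] at this

theorem outerUnitNormal_vadd (L : Set E) (x y : E) :
    outerUnitNormal (x +ᵥ L) (x + y) = outerUnitNormal L y := by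
  by_cases h : ∃! u, IsOuterUnitNormal L y u
  · have h' : ∃! u, IsOuterUnitNormal (x +ᵥ L) (x + y) u := by
      simpa only [isOuterUnitNormal_vadd_iff] using h
    exact outerUnitNormal_eq h' ((outerUnitNormal_spec h).vadd x)
  · have h' : ¬ ∃! u, IsOuterUnitNormal (x +ᵥ L) (x + y) u := by
      simpa only [isOuterUnitNormal_vadd_iff] using h
    rw [outerUnitNormal, outerUnitNormal, dif_neg h, dif_neg h']

/-- A strictly convex set touches each of its supporting hyperplanes in only one point. -/
theorem IsOuterUnitNormal.inner_neg_of_ne (hK : StrictConvex ℝ K) (hu : IsOuterUnitNormal K y u)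
    (hy : y ∈ K) (hz : z ∈ K) (hzy : z ≠ y) : inner ℝ u (z - y) < 0 := by
  have hm : (1 / 2 : ℝ) • z + (1 / 2 : ℝ) • y ∈ interior K :=
    hK hz hy hzy (by norm_num) (by norm_num) (by norm_num)
  have h := hu.inner_neg_of_mem_interior hm
  have h2 : (1 / 2 : ℝ) • z + (1 / 2 : ℝ) • y - y = (1 / 2 : ℝ) • (z - y) := by module
  rw [h2, inner_smul_right] at h
  linarith

/-- With `y` fixed by the homothety, `x + τz` is the convex combination `τz + (1 - τ)y`. -/
theorem vadd_smul_subset (hK : Convex ℝ K) (hτ : 0 < τ) (h1 : τ ≤ 1) (hy : y ∈ K)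
    (hfix : x + τ • y = y) : x +ᵥ τ • K ⊆ K := by
  intro z hz
  rw [mem_vadd_smul_iff hτ] at hz
  have := hK hz hy hτ.le (sub_nonneg.2 h1) (by ring)
  rw [smul_smul, mul_inv_cancel₀ hτ.ne', one_smul] at this
  convert this using 1
  have hx : x = y - τ • y := eq_sub_of_add_eq hfix
  rw [hx]; module

theorem subset_vadd_smul (hK : Convex ℝ K) (h1 : 1 ≤ τ) (hy : y ∈ K)
    (hfix : x + τ • y = y) : K ⊆ x +ᵥ τ • K := by
  intro z hz
  have hτ : 0 < τ := by linarith
  rw [mem_vadd_smul_iff hτ]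
  have := hK hz hy (inv_nonneg.2 hτ.le) (sub_nonneg.2 (inv_le_one_of_one_le₀ h1)) (by ring)
  convert this using 1
  have hx : x = y - τ • y := eq_sub_of_add_eq hfix
  rw [hx]
  have : y = τ⁻¹ • (τ • y) := by rw [smul_smul, inv_mul_cancel₀ hτ.ne', one_smul]
  calc τ⁻¹ • (z - (y - τ • y)) = τ⁻¹ • z - τ⁻¹ • y + τ⁻¹ • (τ • y) := by module
    _ = _ := by rw [← this]; module

theorem volume_real_vadd_smul (hτ : 0 < τ) (x : E) :
    volume.real (x +ᵥ τ • K) = τ ^ n * volume.real K := by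
  rw [measureReal_def, measure_vadd, Measure.addHaar_smul, finrank_euclideanSpace_fin,
    ENNReal.toReal_mul, ENNReal.toReal_ofReal (abs_nonneg _), abs_of_pos (pow_pos hτ n)]
  rfl

theorem min_mul_le_left (K : Set E) (τ : ℝ) :
    min 1 (τ ^ n) * volume.real K ≤ volume.real K := by
  calc _ ≤ 1 * volume.real K := by gcongr; exact min_le_left _ _
    _ = _ := one_mul _

theorem min_mul_le_right (K : Set E) (hτ : 0 < τ) (x : E) :
    min 1 (τ ^ n) * volume.real K ≤ volume.real (x +ᵥ τ • K) := by
  rw [volume_real_vadd_smul hτ]; gcongr; exact min_le_right _ _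

theorem not_subset_of_intersectionVolume_lt (hτ : 0 < τ)
    (h : intersectionVolume K τ x < min 1 (τ ^ n) * volume.real K) :
    ¬ K ⊆ x +ᵥ τ • K ∧ ¬ x +ᵥ τ • K ⊆ K := by
  constructor
  · intro hs
    rw [intersectionVolume, inter_eq_self_of_subset_left hs] at h
    exact absurd (min_mul_le_left K τ) (not_le.2 h)
  · intro hs
    rw [intersectionVolume, inter_eq_self_of_subset_right hs] at h
    exact absurd (min_mul_le_right K hτ x) (not_le.2 h)

/-- A fixed point of `z ↦ x + τz` in `K` would nest the two bodies, making the intersection the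
smaller of them. -/
theorem ne_of_intersectionVolume_lt (hK : Convex ℝ K) (hτ : 0 < τ)
    (h : intersectionVolume K τ x < min 1 (τ ^ n) * volume.real K) (hy : y ∈ K) :
    x + τ • y ≠ y := fun hfix => by
  obtain ⟨h1, h2⟩ := not_subset_of_intersectionVolume_lt hτ h
  rcases le_total τ 1 with hτ1 | hτ1
  · exact h2 (vadd_smul_subset hK hτ hτ1 hy hfix)
  · exact h1 (subset_vadd_smul hK hτ1 hy hfix)

/-- The boundary of a convex set is null, so a closed convex set without interior has volume zero.
-/
theorem interior_inter_nonempty (hKc : IsCompact K) (hK : Convex ℝ K)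
    (h : 0 < intersectionVolume K τ x) : (interior (K ∩ (x +ᵥ τ • K))).Nonempty := by
  by_contra hne
  rw [not_nonempty_iff_eq_empty] at hne
  have hc : Convex ℝ (K ∩ (x +ᵥ τ • K)) := hK.inter (convex_vadd_smul hK x τ)
  have h0 := hc.addHaar_frontier volume
  rw [frontier, hne, sdiff_empty,
    (hKc.isClosed.inter (isCompact_vadd_smul hKc x τ).isClosed).closure_eq] at h0
  rw [intersectionVolume, measureReal_def, h0] at h
  simp at h

/-- The boundaries of `K` and of `x + τK` share only a null set. -/
theorem euclideanHausdorffMeasure_frontier_inter_frontier (hKc : IsCompact K)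
    (hKint : (interior K).Nonempty) (hK : StrictConvex ℝ K) (hτ : 0 < τ)
    (hpos : 0 < intersectionVolume K τ x)
    (h : intersectionVolume K τ x < min 1 (τ ^ n) * volume.real K ∨ (2 ≤ n ∧ τ ≠ 1)) :
    μHE[n - 1] (frontier K ∩ frontier (x +ᵥ τ • K)) = 0 := by
  have hLc := isCompact_vadd_smul hKc x τ
  have hLint := interior_vadd_smul_nonempty hKint hτ x
  have hLcv := convex_vadd_smul hK.convex x τ
  have hsub : frontier K ∩ frontier (x +ᵥ τ • K) ⊆
      {y | y ∈ K ∧ y ∈ x +ᵥ τ • K ∧ ∃ u v, IsOuterUnitNormal K y u ∧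
        IsOuterUnitNormal (x +ᵥ τ • K) y v ∧ u ≠ v ∧ u ≠ -v} ∪ {y ∈ K | x + τ • y = y} := by
    rintro y ⟨hyK, hyL⟩
    obtain ⟨u, hu⟩ := exists_isOuterUnitNormal hK.convex hKint hyK
    obtain ⟨v, hv⟩ := exists_isOuterUnitNormal hLcv hLint hyL
    have hyK' := hKc.isClosed.frontier_subset hyK
    have hyL' := hLc.isClosed.frontier_subset hyL
    by_cases huv : u = v
    -- A common normal `u` supports `K` both at `y` and at the preimage `τ⁻¹ • (y - x)`; strict
    -- convexity makes the two points equal.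
    · refine Or.inr ⟨hyK', ?_⟩
      subst huv
      by_contra hne
      have hz : τ⁻¹ • (y - x) ∈ K := (mem_vadd_smul_iff hτ).1 hyL'
      have hzy : τ⁻¹ • (y - x) ≠ y := fun heq => hne (by
        conv_lhs => rw [← heq, smul_smul, mul_inv_cancel₀ hτ.ne', one_smul, add_sub_cancel])
      have h1 := hu.inner_neg_of_ne hK hyK' hz hzy
      have h2 := (hv.of_vadd_smul hτ).inner_neg_of_ne hK hz hyK' hzy.symm
      rw [← neg_sub, inner_neg_right] at h2
      linarith
    · exact Or.inl ⟨hyK', hyL', u, v, hu, hv, huv,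
        ne_neg_of_isOuterUnitNormal (interior_inter_nonempty hKc hK.convex hpos) hu hv⟩
  refine measure_mono_null hsub (measure_union_null
    (euclideanHausdorffMeasure_independent_normals _ _) ?_)
  -- Below the maximum there is no fixed point in `K`. Otherwise `τ ≠ 1` leaves at most one, and `n
  -- ≥ 2` makes points null; for `n = 1` the measure would count them.
  rcases h with h | ⟨hn, hτ1⟩
  · convert measure_empty (μ := (μHE[n - 1] : Measure E))
    exact eq_empty_of_forall_notMem fun y hy => ne_of_intersectionVolume_lt hK.convex hτ h hy.1 hy.2
  · have hss : {y ∈ K | x + τ • y = y}.Subsingleton := by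
      rintro y ⟨-, hy⟩ z ⟨-, hz⟩
      have h1 : (τ - 1) • (y - z) = 0 := by
        linear_combination (norm := module) hy - hz
      exact sub_eq_zero.1 ((smul_eq_zero.1 h1).resolve_left (sub_ne_zero.2 hτ1))
    rw [Measure.euclideanHausdorffMeasure_def, Measure.smul_apply]
    have : NullSingletonClass (μH[((n - 1 : ℕ) : ℝ)] : Measure E) :=
      Measure.nullSingletonClass_hausdorff E (by exact_mod_cast (by omega : 0 < n - 1))
    rw [hss.measure_zero, smul_zero]

/-! ### Line derivatives of the intersection volume -/

theorem intersectionVolume_add (K : Set E) (τ t : ℝ) (x v : E) :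
    intersectionVolume K τ (x + t • v) = volume.real (K ∩ (t • v +ᵥ (x +ᵥ τ • K))) := by
  rw [intersectionVolume, vadd_vadd, add_comm x]

/-- Translating the whole intersection by `-tv` freezes `x + τK` and moves `K` instead; this is the
source of the minus sign in the second formula. -/
theorem intersectionVolume_add' (K : Set E) (τ t : ℝ) (x v : E) :
    intersectionVolume K τ (x + t • v) = volume.real ((x +ᵥ τ • K) ∩ (t • (-v) +ᵥ K)) := by
  rw [intersectionVolume_add, measureReal_def, measureReal_def,
    ← measure_vadd volume (t • -v) (K ∩ (t • v +ᵥ (x +ᵥ τ • K))), vadd_set_inter, vadd_vadd,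
    smul_neg, neg_add_cancel, zero_vadd, inter_comm]

theorem hasLineDerivAt_intersectionVolume_left (hn : 1 ≤ n) (hKc : IsCompact K)
    (hKint : (interior K).Nonempty) (hK : StrictConvex ℝ K) (hτ : 0 < τ)
    (hpos : 0 < intersectionVolume K τ x)
    (h : intersectionVolume K τ x < min 1 (τ ^ n) * volume.real K ∨ (2 ≤ n ∧ τ ≠ 1))
    (he : ‖e‖ = 1) :
    HasLineDerivAt ℝ (intersectionVolume K τ)
      (∫ y in K, inner ℝ (outerUnitNormal (x +ᵥ τ • K) y) e ∂surfaceMeasure (x +ᵥ τ • K)) x e := by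
  have := hasDerivAt_volume_inter_vadd hn hKc hK.convex (isCompact_vadd_smul hKc x τ)
    (convex_vadd_smul hK.convex x τ) (interior_vadd_smul_nonempty hKint hτ x)
    (euclideanHausdorffMeasure_frontier_inter_frontier hKc hKint hK hτ hpos h) he
  simpa only [HasLineDerivAt, intersectionVolume_add] using this

theorem hasLineDerivAt_intersectionVolume_right (hn : 1 ≤ n) (hKc : IsCompact K)
    (hKint : (interior K).Nonempty) (hK : StrictConvex ℝ K) (hτ : 0 < τ)
    (hpos : 0 < intersectionVolume K τ x)
    (h : intersectionVolume K τ x < min 1 (τ ^ n) * volume.real K ∨ (2 ≤ n ∧ τ ≠ 1))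
    (he : ‖e‖ = 1) :
    HasLineDerivAt ℝ (intersectionVolume K τ)
      (-∫ y in x +ᵥ τ • K, inner ℝ (outerUnitNormal K y) e ∂surfaceMeasure K) x e := by
  have hnull := euclideanHausdorffMeasure_frontier_inter_frontier hKc hKint hK hτ hpos h
  rw [inter_comm] at hnull
  have := hasDerivAt_volume_inter_vadd hn (isCompact_vadd_smul hKc x τ)
    (convex_vadd_smul hK.convex x τ) hKc hK.convex hKint hnull (e := -e) (by rwa [norm_neg])
  simpa only [HasLineDerivAt, intersectionVolume_add', inner_neg_right, integral_neg] using this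

/-- The vector integral of the normals over the part of the boundary of `x + τK` in `K`. -/
noncomputable def intersectionGradient (K : Set E) (τ : ℝ) (x : E) : E :=
  ∫ y in K, outerUnitNormal (x +ᵥ τ • K) y ∂surfaceMeasure (x +ᵥ τ • K)

theorem inner_intersectionGradient (hn : 1 ≤ n) (hKc : IsCompact K)
    (hKint : (interior K).Nonempty) (hK : Convex ℝ K) (hτ : 0 < τ) (x w : E) :
    inner ℝ (intersectionGradient K τ x) w =
      ∫ y in K, inner ℝ (outerUnitNormal (x +ᵥ τ • K) y) w ∂surfaceMeasure (x +ᵥ τ • K) := by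
  have hI := integrable_outerUnitNormal hn (convex_vadd_smul hK x τ) (isCompact_vadd_smul hKc x τ)
    (interior_vadd_smul_nonempty hKint hτ x)
  rw [intersectionGradient, real_inner_comm, ← integral_inner hI.integrableOn]
  simp only [real_inner_comm w]

theorem hasLineDerivAt_intersectionVolume (hn : 1 ≤ n) (hKc : IsCompact K)
    (hKint : (interior K).Nonempty) (hK : StrictConvex ℝ K) (hτ : 0 < τ)
    (hpos : 0 < intersectionVolume K τ x)
    (h : intersectionVolume K τ x < min 1 (τ ^ n) * volume.real K) (w : E) :
    HasLineDerivAt ℝ (intersectionVolume K τ) (inner ℝ (intersectionGradient K τ x) w) x w := by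
  rcases eq_or_ne w 0 with rfl | hw
  · rw [inner_zero_right]; exact hasLineDerivAt_zero
  have he : ‖‖w‖⁻¹ • w‖ = 1 := by
    rw [norm_smul, norm_inv, norm_norm, inv_mul_cancel₀ (norm_ne_zero_iff.2 hw)]
  have := (hasLineDerivAt_intersectionVolume_left hn hKc hKint hK hτ hpos (Or.inl h) he).smul ‖w‖
  rw [← inner_intersectionGradient hn hKc hKint hK.convex hτ, smul_smul,
    mul_inv_cancel₀ (norm_ne_zero_iff.2 hw), one_smul, ← inner_smul_right_eq_smul, smul_smul,
    mul_inv_cancel₀ (norm_ne_zero_iff.2 hw), one_smul] at this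
  exact this

/-! ### Continuity of the gradient and of the volume -/

theorem frontier_vadd (x : E) (A : Set E) : frontier (x +ᵥ A) = x +ᵥ frontier A :=
  ((Homeomorph.vadd x).image_frontier A).symm

/-- Translating back to the fixed surface `∂(τK)` leaves `x` only in the indicator, as dominated
convergence needs. -/
theorem intersectionGradient_eq (K : Set E) (hKm : MeasurableSet K) (τ : ℝ) (x : E) :
    intersectionGradient K τ x = ∫ z in frontier (τ • K),
      indicator ((fun z => x + z) ⁻¹' K) (outerUnitNormal (τ • K)) z ∂μHE[n - 1] := by
  have hmp : MeasurePreserving (fun z : E => x + z) μHE[n - 1] μHE[n - 1] :=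
    (IsometryEquiv.addLeft x).measurePreserving_euclideanHausdorffMeasure (n - 1)
  have hemb : MeasurableEmbedding (fun z : E => x + z) :=
    (Homeomorph.addLeft x).measurableEmbedding
  have hpre : (fun z : E => x + z) ⁻¹' (K ∩ frontier (x +ᵥ τ • K)) =
      frontier (τ • K) ∩ (fun z => x + z) ⁻¹' K := by
    rw [frontier_vadd, inter_comm K, preimage_inter]
    congr 1
    ext z
    rw [mem_preimage, ← vadd_eq_add, vadd_mem_vadd_set_iff]
  rw [setIntegral_indicator (hKm.preimage hemb.measurable), intersectionGradient, surfaceMeasure,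
    Measure.restrict_restrict hKm, ← hmp.setIntegral_preimage_emb hemb, hpre]
  simp only [outerUnitNormal_vadd]

theorem continuousAt_indicator_preimage_const {F : Type*} [TopologicalSpace F] [Zero F] {z : E}
    (c : F) (h : x + z ∉ frontier K) :
    ContinuousAt (fun x => indicator ((fun z => x + z) ⁻¹' K) (fun _ => c) z) x := by
  have hc : Filter.Tendsto (fun x : E => x + z) (nhds x) (nhds (x + z)) :=
    (continuous_id.add continuous_const).tendsto x
  by_cases hz : x + z ∈ closure K
  · have hi : x + z ∈ interior K := by_contra fun hi => h ⟨hz, hi⟩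
    refine (continuousAt_const (y := c)).congr ?_
    filter_upwards [hc.eventually (mem_interior_iff_mem_nhds.1 hi)] with x' hx'
    exact (indicator_of_mem (s := (fun z => x' + z) ⁻¹' K) hx' (fun _ => c)).symm
  · refine (continuousAt_const (y := (0 : F))).congr ?_
    filter_upwards [hc.eventually (isClosed_closure.isOpen_compl.mem_nhds hz)] with x' hx'
    exact (indicator_of_notMem (s := (fun z => x' + z) ⁻¹' K)
      (fun h' => hx' (subset_closure h')) (fun _ => c)).symm

theorem continuousAt_intersectionGradient (hn : 1 ≤ n) (hKc : IsCompact K)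
    (hKint : (interior K).Nonempty) (hK : StrictConvex ℝ K) (hτ : 0 < τ)
    (hpos : 0 < intersectionVolume K τ x)
    (h : intersectionVolume K τ x < min 1 (τ ^ n) * volume.real K) :
    ContinuousAt (intersectionGradient K τ) x := by
  have hKm := hKc.isClosed.measurableSet
  have hI := integrable_outerUnitNormal hn (convex_vadd_smul hK.convex 0 τ)
    (isCompact_vadd_smul hKc 0 τ) (interior_vadd_smul_nonempty hKint hτ 0)
  rw [zero_vadd] at hI
  have hfin := euclideanHausdorffMeasure_frontier_lt_top hn (convex_vadd_smul hK.convex 0 τ)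
    (isCompact_vadd_smul hKc 0 τ) (interior_vadd_smul_nonempty hKint hτ 0)
  rw [zero_vadd] at hfin
  have hpre : ∀ x : E, MeasurableSet ((fun z => x + z) ⁻¹' K) := fun x =>
    hKm.preimage (measurable_const_add x)
  have hfun : intersectionGradient K τ = fun x => ∫ z in frontier (τ • K),
      indicator ((fun z => x + z) ⁻¹' K) (outerUnitNormal (τ • K)) z ∂μHE[n - 1] :=
    funext fun x => intersectionGradient_eq K hKm τ x
  rw [hfun]
  refine continuousAt_of_dominated (bound := fun _ => 1)
    (.of_forall fun x' => hI.aestronglyMeasurable.indicator (hpre x'))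
    (.of_forall fun x' => .of_forall fun z => ?_) (integrableOn_const hfin.ne) ?_
  · exact (norm_indicator_le_norm_self _ _).trans (norm_outerUnitNormal_le _ _)
  · have hnull := euclideanHausdorffMeasure_frontier_inter_frontier hKc hKint hK hτ hpos (Or.inl h)
    rw [ae_restrict_iff' isClosed_frontier.measurableSet]
    have hmp : MeasurePreserving (fun z : E => x + z) μHE[n - 1] μHE[n - 1] :=
      (IsometryEquiv.addLeft x).measurePreserving_euclideanHausdorffMeasure (n - 1)
    -- The integrand can jump at `x` only for `z` with `x + z ∈ ∂K`; these are the common boundary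
    -- points, translated by `-x`.
    have h0 := (hmp.measure_preimage
      (isClosed_frontier.inter isClosed_frontier).measurableSet.nullMeasurableSet).trans hnull
    filter_upwards [measure_eq_zero_iff_ae_notMem.1 h0] with z hz hzf
    have hxz : x + z ∉ frontier K := fun hf => hz ⟨hf, by
      rw [frontier_vadd]; exact ⟨z, hzf, rfl⟩⟩
    exact continuousAt_indicator_preimage_const (outerUnitNormal (τ • K) z) hxz

theorem continuous_intersectionVolume (hKc : IsCompact K) (hK : Convex ℝ K) (τ : ℝ) :
    Continuous (intersectionVolume K τ) := by
  have hKm := hKc.isClosed.measurableSet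
  have hT : MeasurableSet (τ • K) := (hKc.smul τ).isClosed.measurableSet
  have hpre : ∀ x : E, MeasurableSet ((fun z => x + z) ⁻¹' K) := fun x =>
    hKm.preimage (measurable_const_add x)
  have hfun : intersectionVolume K τ = fun x => ∫ z in τ • K,
      indicator ((fun z => x + z) ⁻¹' K) (fun _ => (1 : ℝ)) z := by
    funext x
    rw [setIntegral_indicator (hpre x), setIntegral_const, smul_eq_mul, mul_one, intersectionVolume,
      measureReal_def, measureReal_def, ← measure_vadd volume x (τ • K ∩ _), vadd_set_inter,
      inter_comm]
    congr 3
    ext y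
    rw [mem_vadd_set_iff_neg_vadd_mem, mem_preimage, vadd_eq_add, add_neg_cancel_left]
  rw [hfun]
  refine continuous_iff_continuousAt.2 fun x => ?_
  refine continuousAt_of_dominated (bound := fun _ => 1)
    (.of_forall fun x' => (aestronglyMeasurable_const).indicator (hpre x'))
    (.of_forall fun x' => .of_forall fun z => ?_)
    (integrableOn_const (hKc.smul τ).measure_lt_top.ne) ?_
  · exact (norm_indicator_le_norm_self _ _).trans (by simp)
  · refine ae_restrict_of_ae ?_
    have h0 : volume ((fun z : E => x + z) ⁻¹' frontier K) = 0 := by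
      rw [measure_preimage_add]
      exact hK.addHaar_frontier volume
    filter_upwards [measure_eq_zero_iff_ae_notMem.1 h0] with z hz
    exact continuousAt_indicator_preimage_const 1 hz

/-! ### Nonvanishing of the gradient -/

theorem inter_frontier_nonempty_of_isPreconnected {S A : Set E} (hS : IsPreconnected S)
    (h1 : (S ∩ A).Nonempty) (h2 : (S ∩ Aᶜ).Nonempty) (hA : IsClosed A) :
    (S ∩ frontier A).Nonempty := by
  by_contra hne
  have hcov : S ⊆ interior A ∪ Aᶜ := fun z hz => by
    by_cases hzA : z ∈ A
    · exact Or.inl (by_contra fun hi => hne ⟨z, hz, subset_closure hzA, hi⟩)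
    · exact Or.inr hzA
  obtain ⟨z, hz, hzA⟩ := h1
  have hzi : z ∈ interior A := (hcov hz).resolve_right fun h => h hzA
  obtain ⟨q, -, hq1, hq2⟩ := hS _ _ isOpen_interior hA.isOpen_compl hcov ⟨z, hz, hzi⟩ h2
  exact hq2 (interior_subset hq1)

/-- A nonempty relatively open part of the boundary of a convex body has positive area. -/
theorem euclideanHausdorffMeasure_inter_frontier_pos (hn : 1 ≤ n) {U : Set E} (hU : IsOpen U)
    (hLc : IsClosed L) (hL : Convex ℝ L) (hint : (interior L).Nonempty)
    (hne : (U ∩ frontier L).Nonempty) : 0 < μHE[n - 1] (U ∩ frontier L) := by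
  obtain ⟨y, hyU, hyL⟩ := hne
  obtain ⟨x₀, hx₀⟩ := hint
  obtain ⟨R, hR, e, he, rfl⟩ : ∃ R : ℝ, 0 < R ∧ ∃ e : E, ‖e‖ = 1 ∧ x₀ = y - R • e := by
    have hyx : 0 < ‖y - x₀‖ := norm_pos_iff.2 (sub_ne_zero.2 fun h => hyL.2 (h ▸ hx₀))
    refine ⟨_, hyx, ‖y - x₀‖⁻¹ • (y - x₀), ?_, ?_⟩
    · rw [norm_smul, norm_inv, norm_norm, inv_mul_cancel₀ hyx.ne']
    · rw [smul_smul, mul_inv_cancel₀ hyx.ne', one_smul, sub_sub_cancel]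
  obtain ⟨r, hr, hball⟩ := Metric.isOpen_iff.1 hU y hyU
  set ε := min (r / 2) R with hε
  have hε0 : 0 < ε := lt_min (by positivity) hR
  have hεr : ε ≤ r / 2 := min_le_left _ _
  have hεx : ε ≤ R := min_le_right _ _
  have hyL' : y ∈ L := hLc.frontier_subset hyL
  have hc : y - ε • e ∈ interior L := by
    have := hL.combo_interior_self_mem_interior hx₀ hyL' (a := ε / R)
      (b := 1 - ε / R) (by positivity) (sub_nonneg.2 (div_le_one_of_le₀ hεx hR.le)) (by ring)
    convert this using 1
    calc y - ε • e = y - (ε / R * R) • e := by rw [div_mul_cancel₀ _ hR.ne']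
      _ = _ := by module
  have hq : y + ε • e ∈ Lᶜ := fun hq => hyL.2 (by
    have := hL.combo_interior_self_mem_interior hc hq (a := 1 / 2) (b := 1 / 2)
      (by norm_num) (by norm_num) (by norm_num)
    convert this using 1
    module)
  set w₀ := perpProj e y with hw₀
  -- These are the small sideways shifts of the segment from `y - εe` to `y + εe` that keep its
  -- lower end inside and its upper end outside `L`. Each shifted segment crosses `∂L`, so the
  -- shadow contains an open set.
  set O : Set (Submodule.span ℝ {e})ᗮ := {w | ((w - w₀ : (Submodule.span ℝ {e})ᗮ) : E) + (y - ε • e) ∈ interior L} ∩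
    {w | ((w - w₀ : (Submodule.span ℝ {e})ᗮ) : E) + (y + ε • e) ∈ Lᶜ} ∩ {w | ‖w - w₀‖ < r / 2} with hO
  have hOo : IsOpen O := by
    refine ((isOpen_interior.preimage ?_).inter (hLc.isOpen_compl.preimage ?_)).inter
      (isOpen_lt ?_ continuous_const) <;> fun_prop
  have hw₀O : w₀ ∈ O := by
    refine ⟨⟨?_, ?_⟩, ?_⟩
    · simpa using hc
    · simpa using hq
    · simpa using hr
  have hsub : O ⊆ perpProj e '' (U ∩ frontier L) := by
    rintro w ⟨⟨h1, h2⟩, h3⟩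
    set v : E := ((w - w₀ : (Submodule.span ℝ {e})ᗮ) : E) with hv
    obtain ⟨p, ⟨s, hs, rfl⟩, hpL⟩ := inter_frontier_nonempty_of_isPreconnected
      (S := (fun s : ℝ => v + (y + s • e)) '' Icc (-ε) ε)
      (isPreconnected_Icc.image _ (by fun_prop : Continuous fun s : ℝ => v + (y + s • e)).continuousOn)
      ⟨_, ⟨-ε, ⟨le_rfl, by linarith⟩, rfl⟩, by
        change v + (y + (-ε) • e) ∈ L
        rw [neg_smul, ← sub_eq_add_neg]; exact interior_subset h1⟩
      ⟨_, ⟨ε, ⟨by linarith, le_rfl⟩, rfl⟩, h2⟩ hLc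
    refine ⟨_, ⟨hball ?_, hpL⟩, ?_⟩
    · rw [Metric.mem_ball, dist_eq_norm]
      have h3' : ‖v‖ < r / 2 := h3
      calc ‖v + (y + s • e) - y‖ = ‖v + s • e‖ := by congr 1; abel
        _ ≤ ‖v‖ + ‖s • e‖ := norm_add_le _ _
        _ = ‖v‖ + |s| := by rw [norm_smul, he, mul_one, Real.norm_eq_abs]
        _ < r / 2 + r / 2 := add_lt_add_of_lt_of_le h3' ((abs_le.2 hs).trans hεr)
        _ = r := by ring
    · have : v + (y + s • e) = (w : E) + (inner ℝ e y + s) • e := by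
        rw [hv, Submodule.coe_sub, hw₀, coe_perpProj he]; module
      change perpProj e (v + (y + s • e)) = w
      rw [this, perpProj_line he]
  calc 0 < volume O := hOo.measure_pos volume ⟨w₀, hw₀O⟩
    _ ≤ volume (perpProj e '' (U ∩ frontier L)) := measure_mono hsub
    _ ≤ _ := volume_image_perpProj_le hn he _

theorem setIntegral_inner_outerUnitNormal_neg (hn : 1 ≤ n) {A : Set E} (hA : IsClosed A)
    (hLc : IsCompact L) (hL : Convex ℝ L) (hint : (interior L).Nonempty)
    (hne : (interior A ∩ frontier L).Nonempty) (w : E)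
    (hw : ∀ y ∈ A ∩ regularBoundary L, inner ℝ (outerUnitNormal L y) w < 0) :
    ∫ y in A, inner ℝ (outerUnitNormal L y) w ∂surfaceMeasure L < 0 := by
  have hI : Integrable (fun y => inner ℝ (outerUnitNormal L y) w)
      ((surfaceMeasure L).restrict A) :=
    ((integrable_outerUnitNormal hn hL hLc hint).inner_const w).integrableOn
  have hae : ∀ᵐ y ∂(surfaceMeasure L).restrict A, inner ℝ (outerUnitNormal L y) w < 0 := by
    filter_upwards [ae_restrict_mem hA.measurableSet,
      ae_restrict_of_ae (ae_surfaceMeasure_mem_regularBoundary hL hLc.isClosed hint)] with y h1 h2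
    exact hw y ⟨h1, h2⟩
  have hpos : 0 < ∫ y in A, -inner ℝ (outerUnitNormal L y) w ∂surfaceMeasure L := by
    have h0 : 0 ≤ᵐ[(surfaceMeasure L).restrict A] fun y => -inner ℝ (outerUnitNormal L y) w :=
      hae.mono fun y hy => by
        change 0 ≤ -inner ℝ (outerUnitNormal L y) w
        linarith
    refine lt_of_le_of_ne (integral_nonneg_of_ae h0) fun heq => ?_
    have hz := (integral_eq_zero_iff_of_nonneg_ae h0 hI.neg).1 heq.symm
    have hF : ∀ᵐ y ∂(surfaceMeasure L).restrict A, False := by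
      filter_upwards [hae, hz] with y h1 h2
      have h2 : -inner ℝ (outerUnitNormal L y) w = 0 := h2
      linarith
    have hM : (surfaceMeasure L) A = 0 := by
      have := ae_iff.1 hF
      simpa using this
    rw [surfaceMeasure, Measure.restrict_apply hA.measurableSet] at hM
    have := euclideanHausdorffMeasure_inter_frontier_pos hn isOpen_interior hLc.isClosed hL hint hne
    exact this.ne' (measure_mono_null (inter_subset_inter_left _ interior_subset) hM)
  rw [integral_neg] at hpos
  linarith

/-- The gradient of the overlap volume does not vanish below its maximum. -/
theorem intersectionGradient_ne_zero (hn : 1 ≤ n) (hKc : IsCompact K)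
    (hKint : (interior K).Nonempty) (hK : StrictConvex ℝ K) (hτ : 0 < τ)
    (hpos : 0 < intersectionVolume K τ x)
    (h : intersectionVolume K τ x < min 1 (τ ^ n) * volume.real K) :
    intersectionGradient K τ x ≠ 0 := by
  intro hG
  have hLc := isCompact_vadd_smul hKc x τ
  have hLint := interior_vadd_smul_nonempty hKint hτ x
  have hLcv := convex_vadd_smul hK.convex x τ
  obtain ⟨d, hd⟩ := interior_inter_nonempty hKc hK.convex hpos
  rw [interior_inter] at hd
  obtain ⟨hns1, hns2⟩ := not_subset_of_intersectionVolume_lt hτ h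
  -- If the connected interior of `A` met `B` but not `∂B`, it would lie in `B`, and so would its
  -- closure.
  have hmeet : ∀ A B : Set E, IsCompact A → IsCompact B → Convex ℝ A → (interior A).Nonempty →
      ¬ A ⊆ B → d ∈ interior A → d ∈ B → (interior A ∩ frontier B).Nonempty := by
    intro A B hA hB hAc hAi hAB hdA hdB
    refine inter_frontier_nonempty_of_isPreconnected hAc.interior.isPreconnected ⟨d, hdA, hdB⟩ ?_
      hB.isClosed
    by_contra hne
    refine hAB fun z hz => ?_
    have hcl : z ∈ closure (interior A) := by
      rw [hAc.closure_interior_eq_closure_of_nonempty_interior hAi]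
      exact subset_closure hz
    exact closure_minimal (fun q hq => by_contra fun hqB => hne ⟨q, hq, hqB⟩) hB.isClosed hcl
  have hmove : ∀ y ∈ x +ᵥ τ • K, y ∈ K → τ⁻¹ • (y - x) ≠ y := fun y _ hy heq =>
    ne_of_intersectionVolume_lt hK.convex hτ h hy (by
      conv_lhs => rw [← heq, smul_smul, mul_inv_cancel₀ hτ.ne', one_smul, add_sub_cancel])
  rcases le_total 1 τ with hτ1 | hτ1
  · have hneg := setIntegral_inner_outerUnitNormal_neg hn hKc.isClosed hLc hLcv hLint
      (hmeet K _ hKc hLc hK.convex hKint hns1 hd.1 (interior_subset hd.2))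
      -- The test direction is the displacement of `d` under the homothety. By `e1` it splits into a
      -- vector pairing strictly negatively with `u`, by strict convexity of `K` at the preimage of
      -- `y`, and one pairing nonpositively since `d` lies in `x + τK` and `τ ≥ 1`.
      ((τ - 1) • d + x) (by
        rintro y ⟨hyK, hy⟩
        set u := outerUnitNormal (x +ᵥ τ • K) y
        have hu : IsOuterUnitNormal (x +ᵥ τ • K) y u := outerUnitNormal_spec hy.2
        have hyL := hLc.isClosed.frontier_subset hy.1
        have h1 := (hu.of_vadd_smul hτ).inner_neg_of_ne hK ((mem_vadd_smul_iff hτ).1 hyL) hyK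
          (hmove y hyL hyK).symm
        have h2 := hu.2 d (interior_subset hd.2)
        have e1 : (τ - 1) • d + x = τ • (y - τ⁻¹ • (y - x)) + (τ - 1) • (d - y) := by
          rw [smul_sub, smul_smul, mul_inv_cancel₀ hτ.ne']; module
        rw [e1, inner_add_right, inner_smul_right, inner_smul_right]
        have h3 := mul_neg_of_pos_of_neg hτ h1
        have h4 := mul_nonpos_of_nonneg_of_nonpos (sub_nonneg.2 hτ1) h2
        linarith)
    rw [← inner_intersectionGradient hn hKc hKint hK.convex hτ, hG, inner_zero_left] at hneg
    exact lt_irrefl _ hneg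
  · have hneg := setIntegral_inner_outerUnitNormal_neg hn hLc.isClosed hKc hK.convex hKint
      (hmeet _ K hLc hKc hLcv hLint hns2 hd.2 (interior_subset hd.1))
      -- For `τ ≤ 1` the opposite displacement is tested against the normals of `K`, whose integral
      -- also vanishes because both formulas compute the same derivative.
      ((1 - τ) • d - x) (by
        rintro y ⟨hyL, hy⟩
        set u := outerUnitNormal K y
        have hu : IsOuterUnitNormal K y u := outerUnitNormal_spec hy.2
        have hyK := hKc.isClosed.frontier_subset hy.1
        have h1 := hu.inner_neg_of_ne hK hyK ((mem_vadd_smul_iff hτ).1 hyL) (hmove y hyL hyK)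
        have h2 := hu.2 d (interior_subset hd.1)
        have e1 : (1 - τ) • d - x = τ • (τ⁻¹ • (y - x) - y) + (1 - τ) • (d - y) := by
          rw [smul_sub, smul_smul, mul_inv_cancel₀ hτ.ne']; module
        rw [e1, inner_add_right, inner_smul_right, inner_smul_right]
        have h3 := mul_neg_of_pos_of_neg hτ h1
        have h4 := mul_nonpos_of_nonneg_of_nonpos (sub_nonneg.2 hτ1) h2
        linarith)
    have hderiv : ∀ w : E, ‖w‖ = 1 →
        ∫ y in x +ᵥ τ • K, inner ℝ (outerUnitNormal K y) w ∂surfaceMeasure K = 0 := fun w hw => by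
      have d1 := hasLineDerivAt_intersectionVolume hn hKc hKint hK hτ hpos h w
      have d2 := hasLineDerivAt_intersectionVolume_right hn hKc hKint hK hτ hpos (Or.inl h) hw
      have := d1.unique d2
      rw [hG, inner_zero_left] at this
      linarith
    set w := (1 - τ) • d - x
    rcases eq_or_ne w 0 with hw0 | hw0
    · simp [hw0] at hneg
    · have := hderiv (‖w‖⁻¹ • w)
        (by rw [norm_smul, norm_inv, norm_norm, inv_mul_cancel₀ (norm_ne_zero_iff.2 hw0)])
      simp only [inner_smul_right, integral_const_mul] at this
      rcases mul_eq_zero.1 this with h' | h'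
      · exact hw0 (by simpa using h')
      · rw [h'] at hneg
        exact lt_irrefl _ hneg

end Homothets

/-! ### From directional derivatives to a C¹ graph -/

section ContinuouslyDifferentiable

variable {V : Type*} [NormedAddCommGroup V] [InnerProductSpace ℝ V] {F : V → ℝ} {G : V → V}
  {O : Set V} {x : V}

theorem hasDerivAt_line_of_hasLineDerivAt {f : V → ℝ} {f' : ℝ} {w : V} {t : ℝ}
    (h : HasLineDerivAt ℝ f f' (x + t • w) w) :
    HasDerivAt (fun s : ℝ => f (x + s • w)) f' t := by
  have h' : HasDerivAt (fun s : ℝ => f (x + t • w + s • w)) f' (t - t) := by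
    rw [sub_self]; exact h
  refine (h'.comp_sub_const t t).congr_of_eventuallyEq (.of_forall fun s => ?_)
  change f _ = f _
  congr 1
  module

/-- A function with continuous Gateaux derivative is Fréchet differentiable. -/
theorem hasFDerivAt_of_hasLineDerivAt (hO : IsOpen O) (hx : x ∈ O)
    (hF : ∀ y ∈ O, ∀ w, HasLineDerivAt ℝ F (inner ℝ (G y) w) y w) (hG : ContinuousAt G x) :
    HasFDerivAt F (innerSL ℝ (G x)) x := by
  rw [hasFDerivAt_iff_isLittleO_nhds_zero, Asymptotics.isLittleO_iff]
  intro c hc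
  have h1 : ∀ᶠ y in nhds x, y ∈ O ∧ ‖G y - G x‖ < c := by
    refine Filter.Eventually.and (hO.mem_nhds hx) ?_
    filter_upwards [Metric.continuousAt_iff'.1 hG c hc] with y hy
    rwa [← dist_eq_norm]
  obtain ⟨r, hr, hball⟩ := Metric.eventually_nhds_iff_ball.1 h1
  filter_upwards [Metric.ball_mem_nhds (0 : V) hr] with w hw
  rw [mem_ball_zero_iff] at hw
  have hmem : ∀ t ∈ Icc (0 : ℝ) 1, x + t • w ∈ Metric.ball x r := fun t ht => by
    rw [Metric.mem_ball, dist_eq_norm, add_sub_cancel_left, norm_smul, Real.norm_eq_abs,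
      abs_of_nonneg ht.1]
    calc t * ‖w‖ ≤ 1 * ‖w‖ := by gcongr; exact ht.2
      _ < r := by rwa [one_mul]
  -- Mean value inequality on the segment from `x` to `x + w`, after subtracting the candidate
  -- linear part.
  have key := norm_image_sub_le_of_norm_deriv_le_segment_01'
    (f := fun t : ℝ => F (x + t • w) - t * inner ℝ (G x) w)
    (f' := fun t => inner ℝ (G (x + t • w)) w - inner ℝ (G x) w) (C := c * ‖w‖)
    (fun t ht => by
      have hd := hasDerivAt_line_of_hasLineDerivAt (hF _ (hball _ (hmem t ht)).1 w)
      have hl := (hasDerivAt_id t).mul_const (inner ℝ (G x) w)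
      rw [one_mul] at hl
      exact (hd.sub hl).hasDerivWithinAt)
    (fun t ht => by
      rw [← inner_sub_left]
      refine (norm_inner_le_norm _ _).trans ?_
      gcongr
      exact (hball _ (hmem t (Ico_subset_Icc_self ht))).2.le)
  simp only [one_smul, one_mul, zero_smul, zero_mul, add_zero, sub_zero] at key
  rw [innerSL_apply_apply, sub_right_comm]
  exact key

theorem contDiffAt_one_of_hasLineDerivAt (hO : IsOpen O) (hx : x ∈ O)
    (hF : ∀ y ∈ O, ∀ w, HasLineDerivAt ℝ F (inner ℝ (G y) w) y w)
    (hG : ∀ y ∈ O, ContinuousAt G y) : ContDiffAt ℝ 1 F x :=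
  contDiffAt_one_iff.2 ⟨fun y => innerSL ℝ (G y), O, hO.mem_nhds hx,
    fun y hy => ((innerSL ℝ).continuous.continuousAt.comp (hG y hy)).continuousWithinAt,
    fun _ hy => hasFDerivAt_of_hasLineDerivAt hO hy hF (hG _ hy)⟩

/-- Near a point with nonzero gradient, a superlevel set of a `C¹` function lies on one side of the
graph of a `C¹` function. -/
theorem exists_graph_of_contDiffAt [CompleteSpace V] {p : V} (hO : IsOpen O) (hp : p ∈ O)
    (hF : ∀ y ∈ O, ∀ w, HasLineDerivAt ℝ F (inner ℝ (G y) w) y w)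
    (hG : ∀ y ∈ O, ContinuousAt G y) (hGp : G p ≠ 0) :
    ∃ (u : V) (U : Set V) (g : (Submodule.span ℝ {u})ᗮ → ℝ), ‖u‖ = 1 ∧ IsOpen U ∧ p ∈ U ∧
      (∀ z ∈ U, ContDiffAt ℝ 1 g (perpProj u z)) ∧
      ∀ z ∈ U, F p ≤ F z ↔ inner ℝ u z ≤ g (perpProj u z) := by
  have hGn : 0 < ‖G p‖ := norm_pos_iff.2 hGp
  -- The direction is that of steepest descent, so that the superlevel set lies below the graph.
  obtain ⟨u, hu, hGu⟩ : ∃ u : V, ‖u‖ = 1 ∧ inner ℝ (G p) u < 0 := by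
    refine ⟨-(‖G p‖⁻¹ • G p), by
      rw [norm_neg, norm_smul, norm_inv, norm_norm, inv_mul_cancel₀ hGn.ne'], ?_⟩
    rw [inner_neg_right, inner_smul_right, real_inner_self_eq_norm_sq]
    have : 0 < ‖G p‖⁻¹ * ‖G p‖ ^ 2 := by positivity
    linarith
  set w₀ := perpProj u p with hw₀
  set t₀ : ℝ := inner ℝ u p with ht₀
  have hdec : ∀ z : V, (perpProj u z : V) + inner ℝ u z • u = z := perpProj_add_inner_smul hu
  set Λ : (Submodule.span ℝ {u})ᗮ × ℝ →L[ℝ] V :=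
    (Submodule.span ℝ {u})ᗮ.subtypeL.coprod (ContinuousLinearMap.toSpanSingleton ℝ u) with hΛ
  have hΛa : ∀ (w : (Submodule.span ℝ {u})ᗮ) (t : ℝ), Λ (w, t) = (w : V) + t • u := fun w t => by
    simp [hΛ]
  have hΛp : Λ (w₀, t₀) = p := by rw [hΛa, hdec]
  set f : (Submodule.span ℝ {u})ᗮ × ℝ → ℝ := fun q => F (Λ q) with hf
  have hfp : f (w₀, t₀) = F p := by rw [hf]; exact congrArg F hΛp
  have cdf : ContDiffAt ℝ 1 f (w₀, t₀) := by
    refine ContDiffAt.comp (w₀, t₀) (g := F) ?_ Λ.contDiff.contDiffAt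
    rw [hΛp]
    exact contDiffAt_one_of_hasLineDerivAt hO hp hF hG
  have hfd : HasFDerivAt f ((innerSL ℝ (G p)).comp Λ) (w₀, t₀) := by
    refine HasFDerivAt.comp (w₀, t₀) (g := F) ?_ Λ.hasFDerivAt
    rw [hΛp]
    exact hasFDerivAt_of_hasLineDerivAt hO hp hF (hG p hp)
  -- The partial derivative along the line is multiplication by `⟪G p, u⟫`, which is nonzero.
  have hinv : (fderiv ℝ f (w₀, t₀) ∘L .inr ℝ (Submodule.span ℝ {u})ᗮ ℝ).IsInvertible := by
    refine ⟨ContinuousLinearEquiv.unitsEquivAut ℝ (Units.mk0 (inner ℝ (G p) u) hGu.ne), ?_⟩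
    ext
    rw [hfd.fderiv]
    simp [hΛa]
  set g := cdf.implicitFunction one_ne_zero hinv with hg
  have hg₀ : g w₀ = t₀ := cdf.implicitFunction_apply_self one_ne_zero hinv
  have hgC : ContDiffAt ℝ 1 g w₀ := cdf.contDiffAt_implicitFunction one_ne_zero hinv
  have hgf : ∀ᶠ w in nhds w₀, f (w, g w) = f (w₀, t₀) :=
    cdf.eventually_apply_implicitFunction one_ne_zero hinv
  have hnb : ∀ᶠ y in nhds p, y ∈ O ∧ inner ℝ (G y) u < 0 := by
    refine Filter.Eventually.and (hO.mem_nhds hp) ?_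
    have : ContinuousAt (fun y => inner ℝ (G y) u) p := (hG p hp).inner continuousAt_const
    exact this.eventually_lt_const hGu
  obtain ⟨r, hr, hball⟩ := Metric.eventually_nhds_iff_ball.1 hnb
  have hgt : ∀ᶠ w in nhds w₀, |g w - t₀| < r / 2 := by
    have := Metric.continuousAt_iff'.1 hgC.continuousAt (r / 2) (by positivity)
    simpa only [hg₀, Real.dist_eq] using this
  obtain ⟨O', hO'sub, hO'o, hO'w⟩ := mem_nhds_iff.1 (((hgC.eventually (by simp)).and
    (hgf.and hgt)).and (Metric.ball_mem_nhds w₀ (by positivity : 0 < r / 2)))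
  refine ⟨u, {z | perpProj u z ∈ O'} ∩ {z | |inner ℝ u z - t₀| < r / 2}, g, hu, ?_, ?_, ?_, ?_⟩
  · exact (hO'o.preimage (perpProj u).continuous).inter (isOpen_lt (by fun_prop) continuous_const)
  · exact ⟨hO'w, by rw [mem_ofPred_eq, ht₀, sub_self, abs_zero]; positivity⟩
  · exact fun z hz => (hO'sub hz.1).1.1
  · rintro z ⟨hzO, hzt⟩
    obtain ⟨⟨-, hgw, hgwt⟩, hwb⟩ := hO'sub hzO
    set w := perpProj u z with hw
    rw [dist_eq_norm] at hwb
    have hbox : ∀ t ∈ Metric.ball t₀ (r / 2), (w : V) + t • u ∈ Metric.ball p r := by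
      intro t ht
      rw [Metric.mem_ball, Real.dist_eq] at ht
      rw [mem_ball_iff_norm]
      have : (w : V) + t • u - p = ((w - w₀ : (Submodule.span ℝ {u})ᗮ) : V) + (t - t₀) • u := by
        conv_lhs => rw [← hdec p]
        rw [Submodule.coe_sub]
        module
      rw [this]
      calc _ ≤ ‖((w - w₀ : (Submodule.span ℝ {u})ᗮ) : V)‖ + ‖(t - t₀) • u‖ := norm_add_le _ _
        _ = ‖w - w₀‖ + |t - t₀| := by
          rw [norm_smul, hu, mul_one, Real.norm_eq_abs, Submodule.coe_norm]
        _ < r / 2 + r / 2 := add_lt_add hwb ht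
        _ = r := by ring
    have hd : ∀ t ∈ Metric.ball t₀ (r / 2),
        HasDerivAt (fun s : ℝ => F ((w : V) + s • u)) (inner ℝ (G ((w : V) + t • u)) u) t :=
      fun t ht => hasDerivAt_line_of_hasLineDerivAt (hF _ (hball _ (hbox t ht)).1 u)
    -- Monotonicity along each line turns the level-set equation `f (w, g w) = F p` into the
    -- one-sided description.
    have hanti : StrictAntiOn (fun s : ℝ => F ((w : V) + s • u)) (Metric.ball t₀ (r / 2)) := by
      refine strictAntiOn_of_deriv_neg (convex_ball _ _)
        (fun t ht => (hd t ht).continuousAt.continuousWithinAt) fun t ht => ?_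
      have ht' := interior_subset ht
      rw [(hd t ht').deriv]
      exact (hball _ (hbox t ht')).2
    have hgb : g w ∈ Metric.ball t₀ (r / 2) := by rwa [Metric.mem_ball, Real.dist_eq]
    have hzb : inner ℝ u z ∈ Metric.ball t₀ (r / 2) := by rwa [Metric.mem_ball, Real.dist_eq]
    have hle := hanti.le_iff_ge hgb hzb
    simp only [hw, hdec z] at hle
    rw [← hle, ← hfp, ← hgw, hf]
    simp only [hΛa]
    rfl

end ContinuouslyDifferentiable

/-! ### The convolution body and the theorem -/

section ConvolutionBody

variable {n : ℕ} {K : Set (EuclideanSpace ℝ (Fin n))} {τ δ : ℝ}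

theorem hasC1Boundary_convolutionBody (hn : 1 ≤ n) (hKc : IsCompact K)
    (hKint : (interior K).Nonempty) (hK : StrictConvex ℝ K) (hτ : 0 < τ) (hδ : 0 < δ)
    (hδ' : δ < min 1 (τ ^ n) * volume.real K) : HasC1Boundary (convolutionBody K δ τ) := by
  intro p hp
  have hcont := continuous_intersectionVolume hKc hK.convex τ
  -- By continuity a boundary point lies on the level `δ`, hence strictly between 0 and the maximum,
  -- where the gradient is continuous and nonzero.
  have hFp : δ = intersectionVolume K τ p := frontier_le_subset_eq continuous_const hcont hp
  set O : Set (EuclideanSpace ℝ (Fin n)) := {x | 0 < intersectionVolume K τ x} ∩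
    {x | intersectionVolume K τ x < min 1 (τ ^ n) * volume.real K} with hO
  have hOo : IsOpen O := (isOpen_lt continuous_const hcont).inter (isOpen_lt hcont continuous_const)
  have hpO : p ∈ O := by rw [hFp] at hδ hδ'; exact ⟨hδ, hδ'⟩
  obtain ⟨u, U, g, hu, hU, hpU, hg, hUg⟩ := exists_graph_of_contDiffAt hOo hpO
    (fun y hy w => hasLineDerivAt_intersectionVolume hn hKc hKint hK hτ hy.1 hy.2 w)
    (fun y hy => continuousAt_intersectionGradient hn hKc hKint hK hτ hy.1 hy.2)
    (intersectionGradient_ne_zero hn hKc hKint hK hτ hpO.1 hpO.2)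
  refine ⟨u, U, g, hu, hU, hpU, hg, fun z hz => ?_⟩
  rw [← hUg z hz, ← hFp]
  rfl

end ConvolutionBody

theorem theorem2p4 (n : ℕ) (hn : 1 ≤ n) (K : ConvexBody (EuclideanSpace ℝ (Fin n)))
    (hKint : (interior (K : Set (EuclideanSpace ℝ (Fin n)))).Nonempty)
    (hK : StrictConvex ℝ (K : Set (EuclideanSpace ℝ (Fin n))))
    (τ : ℝ) (hτ : 0 < τ) :
    -- the boundary of the convolution body is of class C¹
    (∀ δ : ℝ, 0 < δ → δ < min 1 (τ ^ n) * volume.real (K : Set (EuclideanSpace ℝ (Fin n))) →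
      HasC1Boundary (convolutionBody (K : Set (EuclideanSpace ℝ (Fin n))) δ τ)) ∧
    -- the normals are a.e. well defined and integrable
    ((∀ᵐ y ∂surfaceMeasure (K : Set (EuclideanSpace ℝ (Fin n))),
        ∃! u, IsOuterUnitNormal (K : Set (EuclideanSpace ℝ (Fin n))) y u) ∧
      Integrable (outerUnitNormal (K : Set (EuclideanSpace ℝ (Fin n))))
        (surfaceMeasure (K : Set (EuclideanSpace ℝ (Fin n))))) ∧
    (∀ x : EuclideanSpace ℝ (Fin n),
      (∀ᵐ y ∂surfaceMeasure (x +ᵥ τ • (K : Set (EuclideanSpace ℝ (Fin n)))),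
        ∃! u, IsOuterUnitNormal (x +ᵥ τ • (K : Set (EuclideanSpace ℝ (Fin n)))) y u) ∧
      Integrable (outerUnitNormal (x +ᵥ τ • (K : Set (EuclideanSpace ℝ (Fin n)))))
        (surfaceMeasure (x +ᵥ τ • (K : Set (EuclideanSpace ℝ (Fin n)))))) ∧
    -- the formulas for the partial derivatives
    (∀ x : EuclideanSpace ℝ (Fin n),
      0 < intersectionVolume (K : Set (EuclideanSpace ℝ (Fin n))) τ x →
      (intersectionVolume (K : Set (EuclideanSpace ℝ (Fin n))) τ x <
          min 1 (τ ^ n) * volume.real (K : Set (EuclideanSpace ℝ (Fin n))) ∨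
        (2 ≤ n ∧ τ ≠ 1)) →
      ∀ i : Fin n,
        HasLineDerivAt ℝ (intersectionVolume (K : Set (EuclideanSpace ℝ (Fin n))) τ)
          (∫ y in (K : Set (EuclideanSpace ℝ (Fin n))),
            inner ℝ (outerUnitNormal (x +ᵥ τ • (K : Set (EuclideanSpace ℝ (Fin n)))) y)
              (EuclideanSpace.single i (1 : ℝ))
            ∂surfaceMeasure (x +ᵥ τ • (K : Set (EuclideanSpace ℝ (Fin n)))))
          x (EuclideanSpace.single i (1 : ℝ)) ∧
        HasLineDerivAt ℝ (intersectionVolume (K : Set (EuclideanSpace ℝ (Fin n))) τ)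
          (-∫ y in x +ᵥ τ • (K : Set (EuclideanSpace ℝ (Fin n))),
            inner ℝ (outerUnitNormal (K : Set (EuclideanSpace ℝ (Fin n))) y)
              (EuclideanSpace.single i (1 : ℝ))
            ∂surfaceMeasure (K : Set (EuclideanSpace ℝ (Fin n))))
          x (EuclideanSpace.single i (1 : ℝ))) := by
  have hKc := K.isCompact
  refine ⟨fun δ hδ hδ' => hasC1Boundary_convolutionBody hn hKc hKint hK hτ hδ hδ',
    ⟨?_, integrable_outerUnitNormal hn K.convex hKc hKint⟩, fun x => ⟨?_, ?_⟩, ?_⟩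
  · exact (ae_surfaceMeasure_mem_regularBoundary K.convex K.isClosed hKint).mono fun y hy => hy.2
  · exact (ae_surfaceMeasure_mem_regularBoundary (convex_vadd_smul K.convex x τ)
      (isCompact_vadd_smul hKc x τ).isClosed (interior_vadd_smul_nonempty hKint hτ x)).mono
      fun y hy => hy.2
  · exact integrable_outerUnitNormal hn (convex_vadd_smul K.convex x τ)
      (isCompact_vadd_smul hKc x τ) (interior_vadd_smul_nonempty hKint hτ x)
  · intro x hpos h i
    have he : ‖EuclideanSpace.single i (1 : ℝ)‖ = 1 := by simp
    exact ⟨hasLineDerivAt_intersectionVolume_left hn hKc hKint hK hτ hpos h he,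
      hasLineDerivAt_intersectionVolume_right hn hKc hKint hK hτ hpos h he⟩
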